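/- Let $\mathcal{E}$ be a category such that * $\mathcal{E}$ is (finitary) extensive: it has finite coproducts, and for all objects $X, Y$ the coproduct functor $\mathcal{E}/X\times\mathcal{E}/Y\to\mathcal{E}/(X+Y)$ is an equivalence; * $\mathcal{E}$ has pullbacks; * $\mathcal{E}$ has pullback-stable coequalisers: $\mathcal{E}$ has coequalisers, and for every morphism $f:X\to Y$ the pullback functor $f^*:\mathcal{E}/Y\to\mathcal{E}/X$ preserves coequalisers; * the forgetful functor $\mathcal{U}:\mathbf{Cat}(\mathcal{E})_1\to\mathbf{Gph}(\mathcal{E})$, from the category of internal categories and internal functors in $\mathcal{E}$ to the category of internal graphs $G_1\rightrightarrows G_0$ in $\mathcal{E}$, has a left adjoint. Then the (strict) $2$-category $\mathbf{Cat}(\mathcal{E})$ of internal categories, internal functors and internal natural transformations in $\mathcal{E}$ has finite $2$-colimits. Here a $2$-category $\mathcal{K}$ has finite $2$-colimits if for every $2$-category $\mathcal{J}$ with finitely many objects and finitely presented hom-categories, every $2$-functor $W:\mathcal{J}^{\mathrm{op}}\to\mathbf{Cat}$ with finitely presented values and every $2$-functor $F:\mathcal{J}\to\mathcal{K}$, the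 $W$-weighted (strict) $2$-colimit of $F$ exists, i.e. there are an object $X$ of $\mathcal{K}$ and a $2$-natural transformation $W\Rightarrow\mathcal{K}(F-,X)$ such that for every object $Y$ of $\mathcal{K}$ the induced functor $$\mathcal{K}(X,Y)\longrightarrow[\mathcal{J}^{\mathrm{op}},\mathbf{Cat}]\bigl(W,\mathcal{K}(F-,Y)\bigr)$$ is an isomorphism of categories. A category is finitely presented if it is isomorphic to the quotient of the free category on a finite graph by the congruence generated by finitely many pairs of parallel paths. -/

import Mathlib

open CategoryTheory CategoryTheory.Limits CategoryTheory.Bicategory Opposite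

universe wJ vJ uJ vW uW w v u

/-! ### Internal graphs and internal categories -/

section Internal

/-- An internal (directed) graph `G₁ ⇉ G₀` in `E`. -/
structure InternalGraph (E : Type u) [Category.{v} E] where
  /-- The object of vertices. -/
  vert : E
  /-- The object of edges. -/
  edge : E
  /-- The source map. -/
  src : edge ⟶ vert
  /-- The target map. -/
  tgt : edge ⟶ vert

namespace InternalGraph

variable {E : Type u} [Category.{v} E]

/-- A morphism of internal graphs. -/
@[ext]
structure Hom (G H : InternalGraph E) where
  /-- The map on vertices. -/
  onVert : G.vert ⟶ H.vert
  /-- The map on edges. -/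
  onEdge : G.edge ⟶ H.edge
  src_comm : onEdge ≫ H.src = G.src ≫ onVert
  tgt_comm : onEdge ≫ H.tgt = G.tgt ≫ onVert

/-- The category `Gph(E)` of internal graphs. -/
instance category : Category (InternalGraph E) where
  Hom := Hom
  id G := ⟨𝟙 _, 𝟙 _, by simp, by simp⟩
  comp f g := ⟨f.onVert ≫ g.onVert, f.onEdge ≫ g.onEdge,
    by rw [Category.assoc, g.src_comm, ← Category.assoc, f.src_comm, Category.assoc],
    by rw [Category.assoc, g.tgt_comm, ← Category.assoc, f.tgt_comm, Category.assoc]⟩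
  id_comp f := Hom.ext (Category.id_comp f.onVert) (Category.id_comp f.onEdge)
  comp_id f := Hom.ext (Category.comp_id f.onVert) (Category.comp_id f.onEdge)
  assoc f g h := Hom.ext (Category.assoc f.onVert g.onVert h.onVert)
    (Category.assoc f.onEdge g.onEdge h.onEdge)

end InternalGraph

theorem pullback_comp_lift {E : Type u} [Category.{v} E] {S T X Y Z : E} {p : X ⟶ Z} {q : Y ⟶ Z}
    [HasPullback p q] (k : S ⟶ T) (f : T ⟶ X) (g : T ⟶ Y) (h : f ≫ p = g ≫ q) {f' : S ⟶ X}
    {g' : S ⟶ Y} (hf : k ≫ f = f') (hg : k ≫ g = g') :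
    k ≫ pullback.lift f g h =
      pullback.lift f' g' (by rw [← hf, ← hg, Category.assoc, h, Category.assoc]) := by
  apply pullback.hom_ext
  · rw [Category.assoc, pullback.lift_fst, pullback.lift_fst, hf]
  · rw [Category.assoc, pullback.lift_snd, pullback.lift_snd, hg]

/-- A category internal to a category `E` with pullbacks. The object of composable pairs is the
pullback of `tgt` along `src`; composition is written in diagrammatic order, so a pair
`(f, g)` with `tgt f = src g` is sent to "`f` followed by `g`". -/
structure InternalCategory (E : Type u) [Category.{v} E] [HasPullbacks E] extends
    InternalGraph E where
  /-- The identity assigner. -/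
  ident : vert ⟶ edge
  /-- The composition map. -/
  mul : pullback tgt src ⟶ edge
  ident_src : ident ≫ src = 𝟙 vert
  ident_tgt : ident ≫ tgt = 𝟙 vert
  mul_src : mul ≫ src = pullback.fst tgt src ≫ src
  mul_tgt : mul ≫ tgt = pullback.snd tgt src ≫ tgt
  ident_mul : pullback.lift (src ≫ ident) (𝟙 edge)
    (by rw [Category.assoc, ident_tgt, Category.comp_id, Category.id_comp]) ≫ mul = 𝟙 edge
  mul_ident : pullback.lift (𝟙 edge) (tgt ≫ ident)
    (by rw [Category.assoc, ident_src, Category.comp_id, Category.id_comp]) ≫ mul = 𝟙 edge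
  /-- Associativity, as an equation between two maps out of the object
  `(edge ×[vert] edge) ×[vert] edge` of composable triples. -/
  mul_assoc :
    pullback.lift (pullback.fst (pullback.snd tgt src ≫ tgt) src ≫ mul)
        (pullback.snd (pullback.snd tgt src ≫ tgt) src)
        (by rw [Category.assoc, mul_tgt, pullback.condition]) ≫ mul =
      pullback.lift
        (pullback.fst (pullback.snd tgt src ≫ tgt) src ≫ pullback.fst tgt src)
        (pullback.lift
            (pullback.fst (pullback.snd tgt src ≫ tgt) src ≫ pullback.snd tgt src)
            (pullback.snd (pullback.snd tgt src ≫ tgt) src)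
            (by rw [Category.assoc, pullback.condition]) ≫ mul)
        (by rw [Category.assoc, Category.assoc, mul_src, pullback.lift_fst_assoc,
              Category.assoc, pullback.condition]) ≫ mul

namespace InternalCategory

variable {E : Type u} [Category.{v} E] [HasPullbacks E]

/-- The composite of two composable generalised arrows `f, g : T ⟶ A₁`. -/
noncomputable def cmp (A : InternalCategory E) {T : E} (f g : T ⟶ A.edge)
    (h : f ≫ A.tgt = g ≫ A.src) : T ⟶ A.edge :=
  pullback.lift f g h ≫ A.mul

section cmp

variable (A : InternalCategory E) {S T : E}

theorem cmp_src (f g : T ⟶ A.edge) (h : f ≫ A.tgt = g ≫ A.src) :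
    A.cmp f g h ≫ A.src = f ≫ A.src := by
  rw [cmp, Category.assoc, A.mul_src, pullback.lift_fst_assoc]

theorem cmp_tgt (f g : T ⟶ A.edge) (h : f ≫ A.tgt = g ≫ A.src) :
    A.cmp f g h ≫ A.tgt = g ≫ A.tgt := by
  rw [cmp, Category.assoc, A.mul_tgt, pullback.lift_snd_assoc]

theorem comp_cmp (k : S ⟶ T) (f g : T ⟶ A.edge) (h : f ≫ A.tgt = g ≫ A.src) :
    k ≫ A.cmp f g h = A.cmp (k ≫ f) (k ≫ g) (by rw [Category.assoc, h, Category.assoc]) := by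
  unfold cmp
  rw [← Category.assoc, pullback_comp_lift k f g h rfl rfl]

theorem cmp_congr {f f' g g' : T ⟶ A.edge} (hf : f = f') (hg : g = g')
    (h : f ≫ A.tgt = g ≫ A.src) :
    A.cmp f g h = A.cmp f' g' (by rw [← hf, ← hg, h]) := by
  subst hf; subst hg; rfl

theorem ident_cmp (x : T ⟶ A.vert) (f : T ⟶ A.edge) (hx : x = f ≫ A.src) :
    A.cmp (x ≫ A.ident) f
      (by rw [Category.assoc, A.ident_tgt, Category.comp_id, hx]) = f := by
  subst hx
  rw [cmp, ← pullback_comp_lift f (A.src ≫ A.ident) (𝟙 A.edge)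
    (by rw [Category.assoc, A.ident_tgt, Category.comp_id, Category.id_comp]) (Category.assoc _ _ _).symm
    (Category.comp_id f), Category.assoc, A.ident_mul, Category.comp_id]

theorem cmp_ident (x : T ⟶ A.vert) (f : T ⟶ A.edge) (hx : x = f ≫ A.tgt) :
    A.cmp f (x ≫ A.ident)
      (by rw [Category.assoc, A.ident_src, Category.comp_id, hx]) = f := by
  subst hx
  rw [cmp, ← pullback_comp_lift f (𝟙 A.edge) (A.tgt ≫ A.ident)
    (by rw [Category.assoc, A.ident_src, Category.comp_id, Category.id_comp]) (Category.comp_id f)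
    (Category.assoc _ _ _).symm, Category.assoc, A.mul_ident, Category.comp_id]

theorem cmp_assoc (f g h : T ⟶ A.edge) (hfg : f ≫ A.tgt = g ≫ A.src)
    (hgh : g ≫ A.tgt = h ≫ A.src) :
    A.cmp (A.cmp f g hfg) h (by rw [cmp_tgt, hgh]) =
      A.cmp f (A.cmp g h hgh) (by rw [cmp_src, hfg]) := by
  have := congrArg (fun x => pullback.lift (pullback.lift f g hfg) h
    (by rw [pullback.lift_snd_assoc, hgh]) ≫ x) A.mul_assoc
  beta_reduce at this
  refine Eq.trans (Eq.trans ?_ this) ?_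
  · rw [cmp, ← Category.assoc]
    congr 1
    refine (pullback_comp_lift _ _ _ _ ?_ (pullback.lift_snd _ _ _)).symm
    rw [pullback.lift_fst_assoc]
    rfl
  · rw [cmp, ← Category.assoc]
    congr 1
    refine pullback_comp_lift _ _ _ _ ?_ ?_
    · rw [pullback.lift_fst_assoc, pullback.lift_fst]
    · rw [cmp, ← Category.assoc]
      congr 1
      refine pullback_comp_lift _ _ _ _ ?_ (pullback.lift_snd _ _ _)
      rw [pullback.lift_fst_assoc, pullback.lift_snd]

end cmp

/-- An internal functor: a morphism of underlying graphs preserving identities and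
composition. -/
@[ext]
structure Fun (A B : InternalCategory E) extends
    InternalGraph.Hom A.toInternalGraph B.toInternalGraph where
  ident_comm : A.ident ≫ onEdge = onVert ≫ B.ident
  mul_comm : A.mul ≫ onEdge =
    pullback.lift (pullback.fst A.tgt A.src ≫ onEdge) (pullback.snd A.tgt A.src ≫ onEdge)
      (by rw [Category.assoc, tgt_comm, ← Category.assoc, pullback.condition, Category.assoc,
            ← src_comm, Category.assoc]) ≫ B.mul

namespace Fun

variable {A B C : InternalCategory E}

theorem cmp_comp (F : Fun A B) {T : E} (f g : T ⟶ A.edge) (h : f ≫ A.tgt = g ≫ A.src) :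
    A.cmp f g h ≫ F.onEdge = B.cmp (f ≫ F.onEdge) (g ≫ F.onEdge)
      (by rw [Category.assoc, F.tgt_comm, ← Category.assoc, h, Category.assoc, Category.assoc,
            F.src_comm]) := by
  rw [cmp, Category.assoc, F.mul_comm, cmp, ← Category.assoc]
  congr 1
  exact pullback_comp_lift _ _ _ _ (pullback.lift_fst_assoc _ _ _ _)
    (pullback.lift_snd_assoc _ _ _ _)

/-- The identity internal functor. -/
protected def id (A : InternalCategory E) : Fun A A where
  toHom := 𝟙 A.toInternalGraph
  ident_comm := (Category.comp_id A.ident).trans (Category.id_comp A.ident).symm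
  mul_comm := by
    change A.mul ≫ 𝟙 _ = pullback.lift (_ ≫ 𝟙 _) (_ ≫ 𝟙 _) _ ≫ A.mul
    rw [Category.comp_id]
    conv_lhs => rw [← Category.id_comp A.mul]
    congr 1
    apply pullback.hom_ext <;> simp

/-- The composite of internal functors. -/
protected def comp (F : Fun A B) (G : Fun B C) : Fun A C where
  toHom := InternalGraph.category.comp F.toHom G.toHom
  ident_comm := by
    change A.ident ≫ F.onEdge ≫ G.onEdge = (F.onVert ≫ G.onVert) ≫ C.ident
    rw [← Category.assoc, F.ident_comm, Category.assoc, G.ident_comm, Category.assoc]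
  mul_comm := by
    change A.mul ≫ F.onEdge ≫ G.onEdge =
      pullback.lift (_ ≫ F.onEdge ≫ G.onEdge) (_ ≫ F.onEdge ≫ G.onEdge) _ ≫ C.mul
    rw [← Category.assoc, F.mul_comm, Category.assoc, G.mul_comm, ← Category.assoc]
    congr 1
    refine pullback_comp_lift _ _ _ _ ?_ ?_
    · rw [pullback.lift_fst_assoc, Category.assoc]
    · rw [pullback.lift_snd_assoc, Category.assoc]

theorem ext' {F G : Fun A B} (h₀ : F.onVert = G.onVert) (h₁ : F.onEdge = G.onEdge) : F = G :=
  Fun.ext h₀ h₁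

end Fun

/-- The category `Cat(E)₁` of internal categories and internal functors. -/
instance category : Category (InternalCategory E) where
  Hom := Fun
  id := Fun.id
  comp := Fun.comp
  id_comp f := Fun.ext' (Category.id_comp f.onVert) (Category.id_comp f.onEdge)
  comp_id f := Fun.ext' (Category.comp_id f.onVert) (Category.comp_id f.onEdge)
  assoc f g h := Fun.ext' (Category.assoc f.onVert g.onVert h.onVert)
    (Category.assoc f.onEdge g.onEdge h.onEdge)

variable (E) in
/-- The forgetful functor `U : Cat(E)₁ ⥤ Gph(E)`. -/
def forgetToGraph : InternalCategory E ⥤ InternalGraph E where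
  obj A := A.toInternalGraph
  map F := Fun.toHom F
  map_id _ := rfl
  map_comp _ _ := rfl

/-- An internal natural transformation `F ⇒ G`, given by its components `A₀ ⟶ B₁`. -/
@[ext]
structure Trans {A B : InternalCategory E} (F G : Fun A B) where
  /-- The components. -/
  app : A.vert ⟶ B.edge
  app_src : app ≫ B.src = F.onVert
  app_tgt : app ≫ B.tgt = G.onVert
  /-- For an arrow `a : x ⟶ y` of `A`: `F a` followed by `app y` equals `app x` followed by
  `G a`. -/
  naturality :
    B.cmp F.onEdge (A.tgt ≫ app) (by rw [Category.assoc, app_src, F.tgt_comm]) =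
      B.cmp (A.src ≫ app) G.onEdge (by rw [Category.assoc, app_tgt, G.src_comm])

namespace Trans

variable {A B C : InternalCategory E}

/-- The identity internal natural transformation. -/
protected def id (F : Fun A B) : Trans F F where
  app := F.onVert ≫ B.ident
  app_src := by rw [Category.assoc, B.ident_src, Category.comp_id]
  app_tgt := by rw [Category.assoc, B.ident_tgt, Category.comp_id]
  naturality := by
    rw [B.cmp_congr rfl (Category.assoc _ _ _).symm,
      B.cmp_congr (Category.assoc _ _ _).symm rfl,
      B.cmp_ident _ _ F.tgt_comm.symm, B.ident_cmp _ _ F.src_comm.symm]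

/-- The vertical composite of internal natural transformations. -/
protected noncomputable def comp {F G H : Fun A B} (α : Trans F G) (β : Trans G H) :
    Trans F H where
  app := B.cmp α.app β.app (by rw [α.app_tgt, β.app_src])
  app_src := by rw [cmp_src, α.app_src]
  app_tgt := by rw [cmp_tgt, β.app_tgt]
  naturality := by
    have h₁ : F.onEdge ≫ B.tgt = (A.tgt ≫ α.app) ≫ B.src := by
      rw [Category.assoc, α.app_src, F.tgt_comm]
    have h₂ : (A.tgt ≫ α.app) ≫ B.tgt = (A.tgt ≫ β.app) ≫ B.src := by
      rw [Category.assoc, α.app_tgt, Category.assoc, β.app_src]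
    have h₃ : (A.src ≫ α.app) ≫ B.tgt = (A.src ≫ β.app) ≫ B.src := by
      rw [Category.assoc, α.app_tgt, Category.assoc, β.app_src]
    have h₄ : (A.src ≫ α.app) ≫ B.tgt = G.onEdge ≫ B.src := by
      rw [Category.assoc, α.app_tgt, G.src_comm]
    have h₅ : G.onEdge ≫ B.tgt = (A.tgt ≫ β.app) ≫ B.src := by
      rw [Category.assoc, β.app_src, G.tgt_comm]
    have h₆ : (A.src ≫ β.app) ≫ B.tgt = H.onEdge ≫ B.src := by
      rw [Category.assoc, β.app_tgt, H.src_comm]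
    rw [B.cmp_congr rfl (B.comp_cmp _ _ _ _), B.cmp_congr (B.comp_cmp _ _ _ _) rfl,
      ← B.cmp_assoc _ _ _ h₁ h₂, B.cmp_congr α.naturality rfl, B.cmp_assoc _ _ _ h₄ h₅,
      B.cmp_congr rfl β.naturality, B.cmp_assoc _ _ _ h₃ h₆]

/-- Whiskering on the left, `A ⟶ B ⇉ C`. -/
protected def whiskerLeft (F : Fun A B) {G H : Fun B C} (α : Trans G H) :
    Trans (F.comp G) (F.comp H) where
  app := F.onVert ≫ α.app
  app_src := by rw [Category.assoc, α.app_src]; rfl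
  app_tgt := by rw [Category.assoc, α.app_tgt]; rfl
  naturality := by
    have := congrArg (fun x => F.onEdge ≫ x) α.naturality
    beta_reduce at this
    rw [C.comp_cmp, C.comp_cmp] at this
    refine Eq.trans (C.cmp_congr rfl ?_ _) (this.trans (C.cmp_congr ?_ rfl _))
    · rw [← Category.assoc, ← F.tgt_comm, Category.assoc]
    · rw [← Category.assoc, F.src_comm, Category.assoc]

/-- Whiskering on the right, `A ⇉ B ⟶ C`. -/
protected def whiskerRight {F G : Fun A B} (α : Trans F G) (H : Fun B C) :
    Trans (F.comp H) (G.comp H) where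
  app := α.app ≫ H.onEdge
  app_src := by rw [Category.assoc, H.src_comm, ← Category.assoc, α.app_src]; rfl
  app_tgt := by rw [Category.assoc, H.tgt_comm, ← Category.assoc, α.app_tgt]; rfl
  naturality := by
    have := congrArg (fun x => x ≫ H.onEdge) α.naturality
    beta_reduce at this
    rw [H.cmp_comp, H.cmp_comp] at this
    exact (C.cmp_congr rfl (Category.assoc _ _ _).symm _).trans
      (this.trans (C.cmp_congr (Category.assoc _ _ _) rfl _))

end Trans

/-- The category of internal functors `A ⟶ B` and internal natural transformations. -/
noncomputable instance homCategory (A B : InternalCategory E) : Category (A ⟶ B) where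
  Hom F G := Trans F G
  id F := Trans.id F
  comp α β := Trans.comp α β
  id_comp α := Trans.ext (B.ident_cmp _ _ (Trans.app_src α).symm)
  comp_id α := Trans.ext (B.cmp_ident _ _ (Trans.app_tgt α).symm)
  assoc α β γ := Trans.ext (B.cmp_assoc (Trans.app α) (Trans.app β) (Trans.app γ)
    (by rw [Trans.app_tgt, Trans.app_src]) (by rw [Trans.app_tgt, Trans.app_src]))

variable {A B C : InternalCategory E}

theorem hom₂_ext {F G : A ⟶ B} {α β : F ⟶ G} (h : Trans.app α = Trans.app β) : α = β :=
  Trans.ext h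

theorem eqToHom_app {F G : A ⟶ B} (h : F = G) :
    Trans.app (eqToHom h) = (Fun.toHom F).onVert ≫ B.ident := by
  subst h; rfl

theorem eqToHom_comp_app {F G H : A ⟶ B} (h : F = G) (β : G ⟶ H) :
    Trans.app (eqToHom h ≫ β) = Trans.app β := by
  subst h; rw [eqToHom_refl, Category.id_comp]

theorem comp_eqToHom_app {F G H : A ⟶ B} (β : F ⟶ G) (h : G = H) :
    Trans.app (β ≫ eqToHom h) = Trans.app β := by
  subst h; rw [eqToHom_refl, Category.comp_id]

theorem eq_conj {F G F' G' : A ⟶ B} (α : F ⟶ G) (β : F' ⟶ G') (h : F = F') (h' : G' = G)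
    (hαβ : Trans.app α = Trans.app β) : α = eqToHom h ≫ β ≫ eqToHom h' := by
  subst h; subst h'
  rw [eqToHom_refl, eqToHom_refl, Category.id_comp, Category.comp_id]
  exact Trans.ext hαβ

/-- Left whiskering of 2-cells in `Cat(E)`. -/
def wLeft (F : A ⟶ B) {G H : B ⟶ C} (α : G ⟶ H) : F ≫ G ⟶ F ≫ H :=
  Trans.whiskerLeft F α

/-- Right whiskering of 2-cells in `Cat(E)`. -/
def wRight {F G : A ⟶ B} (α : F ⟶ G) (H : B ⟶ C) : F ≫ H ⟶ G ≫ H :=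
  Trans.whiskerRight α H

theorem wLeft_id (F : A ⟶ B) (G : B ⟶ C) :
    wLeft F (𝟙 G) = 𝟙 (F ≫ G) :=
  Trans.ext (Category.assoc _ _ _).symm

theorem id_wRight (F : A ⟶ B) (G : B ⟶ C) :
    wRight (𝟙 F) G = 𝟙 (F ≫ G) := by
  refine Trans.ext ?_
  change ((Fun.toHom F).onVert ≫ _) ≫ (Fun.toHom G).onEdge =
    ((Fun.toHom F).onVert ≫ (Fun.toHom G).onVert) ≫ _
  rw [Category.assoc, Fun.ident_comm, Category.assoc]

theorem wLeft_eqToHom (F : A ⟶ B) {G G' : B ⟶ C} (h : G = G') :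
    wLeft F (eqToHom h) =
      eqToHom (congrArg (fun K => F ≫ K) h) := by
  subst h; exact wLeft_id F G

theorem eqToHom_wRight {F F' : A ⟶ B} (h : F = F') (G : B ⟶ C) :
    wRight (eqToHom h) G =
      eqToHom (congrArg (fun K => K ≫ G) h) := by
  subst h; exact id_wRight F G

/-- The 2-category `Cat(E)` of internal categories, internal functors and internal natural
transformations. -/
noncomputable instance bicategory : Bicategory (InternalCategory E) where
  toCategoryStruct := category.toCategoryStruct
  homCategory := homCategory
  whiskerLeft F _ _ α := wLeft F α
  whiskerRight α H := wRight α H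
  associator F G H := eqToIso (Category.assoc F G H)
  leftUnitor F := eqToIso (Category.id_comp F)
  rightUnitor F := eqToIso (Category.comp_id F)
  whiskerLeft_id F G := wLeft_id F G
  whiskerLeft_comp F _ _ _ α β := Trans.ext (comp_cmp _ _ _ _ _)
  id_whiskerLeft α := eq_conj _ _ (Category.id_comp _) (Category.id_comp _).symm
    (Category.id_comp _)
  comp_whiskerLeft F G _ _ α := eq_conj _ _ (Category.assoc _ _ _) (Category.assoc _ _ _).symm
    (Category.assoc _ _ _)
  id_whiskerRight F G := id_wRight F G
  comp_whiskerRight α β F := Trans.ext (Fun.cmp_comp _ _ _ _)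
  whiskerRight_id α := eq_conj _ _ (Category.comp_id _) (Category.comp_id _).symm
    (Category.comp_id _)
  whiskerRight_comp α G H := eq_conj _ _ (Category.assoc _ _ _).symm (Category.assoc _ _ _)
    (Category.assoc _ _ _).symm
  whisker_assoc F _ _ α H := eq_conj _ _ (Category.assoc _ _ _) (Category.assoc _ _ _).symm
    (Category.assoc _ _ _)
  whisker_exchange {A B C F G H I} α β := by
    refine Trans.ext ?_
    have := congrArg (fun x => Trans.app α ≫ x) (Trans.naturality β)
    beta_reduce at this
    rw [comp_cmp, comp_cmp] at this
    refine Eq.trans (C.cmp_congr ?_ rfl _) (this.symm.trans (C.cmp_congr rfl ?_ _))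
    · rw [← Category.assoc, Trans.app_src]; rfl
    · rw [← Category.assoc, Trans.app_tgt]; rfl
  pentagon F G H K := by
    simp only [eqToIso.hom, wLeft_eqToHom, eqToHom_wRight, eqToHom_trans]
  triangle F G := by
    simp only [eqToIso.hom, wLeft_eqToHom, eqToHom_wRight, eqToHom_trans]

/-- `Cat(E)` is a strict 2-category. -/
instance strict : Bicategory.Strict (InternalCategory E) where
  id_comp := Category.id_comp
  comp_id := Category.comp_id
  assoc := Category.assoc
  leftUnitor_eqToIso _ := rfl
  rightUnitor_eqToIso _ := rfl
  associator_eqToIso _ _ _ := rfl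

end InternalCategory

end Internal

/-! ### Pullback-stable coequalisers -/

section Stable

/-- `E` has coequalisers, and for every `f : X ⟶ Y` the pullback functor
`f^* : E/Y ⥤ E/X` preserves coequalisers. -/
class HasPullbackStableCoequalizers (E : Type u) [Category.{v} E] [HasPullbacks E] : Prop where
  hasCoequalizers : HasCoequalizers E
  preserves : ∀ {X Y : E} (f : X ⟶ Y),
    PreservesColimitsOfShape WalkingParallelPair (Over.pullback f)

end Stable

/-! ### Finite 2-colimits -/

section TwoColimits

/-- A category is finitely presented if it is isomorphic to the quotient of the free category on
a finite directed graph by the congruence generated by finitely many pairs of parallel paths. -/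
def IsFinitelyPresentedCategory (C : Type u) [Category.{v} C] : Prop :=
  ∃ (V : Type) (_ : Quiver.{0} V) (r : HomRel (Paths V)) (P : CategoryTheory.Quotient r ⥤ C),
    Finite V ∧ (∀ a b : V, Finite (a ⟶ b)) ∧
    (∀ a b : Paths V, {p : (a ⟶ b) × (a ⟶ b) | r p.1 p.2}.Finite) ∧ P.IsIso

variable {J : Type uJ} [Bicategory.{wJ, vJ} J] {K : Type u} [Bicategory.{w, v} K]

/-- Let `J` and `K` be 2-categories, `W : Jᵒᵖ → Cat` a weight and `F : J → K` a diagram (strict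
2-functors). A `W`-weighted cocone on `F` with vertex `X` is a 2-natural transformation
`W ⇒ K(F -, X)` between 2-functors `Jᵒᵖ → Cat`. -/
@[ext]
structure WeightedCocone (W : StrictPseudofunctor Jᵒᵖ Cat.{vW, uW}) (F : StrictPseudofunctor J K)
    (X : K) where
  /-- The component at `j`, a functor `W(j) ⥤ K(F j, X)`. -/
  app (j : J) : W.obj (op j) ⥤ (F.obj j ⟶ X)
  /-- Naturality at a 1-cell, on objects. -/
  nat_obj {j k : J} (f : j ⟶ k) (x : W.obj (op k)) :
    (app j).obj ((W.map f.op).toFunctor.obj x) = F.map f ≫ (app k).obj x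
  /-- Naturality at a 1-cell, on morphisms. -/
  nat_map {j k : J} (f : j ⟶ k) {x y : W.obj (op k)} (t : x ⟶ y) :
    (app j).map ((W.map f.op).toFunctor.map t) =
      eqToHom (nat_obj f x) ≫ F.map f ◁ (app k).map t ≫ eqToHom (nat_obj f y).symm
  /-- Naturality at a 2-cell. -/
  nat_two {j k : J} {f g : j ⟶ k} (α : f ⟶ g) (x : W.obj (op k)) :
    (app j).map ((W.map₂ (Bicategory.Opposite.op2 α)).toNatTrans.app x) =
      eqToHom (nat_obj f x) ≫ F.map₂ α ▷ (app k).obj x ≫ eqToHom (nat_obj g x).symm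

namespace WeightedCocone

variable {W : StrictPseudofunctor Jᵒᵖ Cat.{vW, uW}} {F : StrictPseudofunctor J K}

/-- A modification between weighted cocones with the same vertex. -/
@[ext]
structure Hom {X : K} (σ τ : WeightedCocone W F X) where
  /-- The component at `j`. -/
  app (j : J) : σ.app j ⟶ τ.app j
  /-- The modification axiom. -/
  nat {j k : J} (f : j ⟶ k) (x : W.obj (op k)) :
    (app j).app ((W.map f.op).toFunctor.obj x) =
      eqToHom (σ.nat_obj f x) ≫ F.map f ◁ (app k).app x ≫ eqToHom (τ.nat_obj f x).symm

/-- The category `[Jᵒᵖ, Cat](W, K(F -, X))` of weighted cocones with vertex `X`. -/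
instance category (X : K) : Category (WeightedCocone W F X) where
  Hom := Hom
  id σ := ⟨fun j => 𝟙 (σ.app j), fun f x => by simp⟩
  comp m n := ⟨fun j => m.app j ≫ n.app j, fun f x => by simp [m.nat, n.nat]⟩
  id_comp m := Hom.ext (funext fun j => Category.id_comp (m.app j))
  comp_id m := Hom.ext (funext fun j => Category.comp_id (m.app j))
  assoc m n p := Hom.ext (funext fun j => Category.assoc (m.app j) (n.app j) (p.app j))

variable [Bicategory.Strict K]

theorem strict_conj_whiskerRight {a b c d : K} {f g : a ⟶ b} {p q : a ⟶ c} (α : f ⟶ g)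
    (u : b ⟶ c) (h : c ⟶ d) (hp : p = f ≫ u) (hq : q = g ≫ u) {β : p ⟶ q}
    (hβ : β = eqToHom hp ≫ α ▷ u ≫ eqToHom hq.symm) :
    β ▷ h = eqToHom ((congrArg (· ≫ h) hp).trans (Bicategory.Strict.assoc _ _ _)) ≫
      α ▷ (u ≫ h) ≫
      eqToHom ((congrArg (· ≫ h) hq).trans (Bicategory.Strict.assoc _ _ _)).symm := by
  subst hp; subst hq; subst hβ
  simp [Bicategory.Strict.associator_eqToIso]

theorem strict_conj_whiskerLeft {a b c d : K} {f : a ⟶ b} {u : b ⟶ c} {p : a ⟶ c}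
    {h k : c ⟶ d} (θ : h ⟶ k) (hp : p = f ≫ u) :
    p ◁ θ = eqToHom ((congrArg (· ≫ h) hp).trans (Bicategory.Strict.assoc _ _ _)) ≫
      f ◁ (u ◁ θ) ≫
      eqToHom ((congrArg (· ≫ k) hp).trans (Bicategory.Strict.assoc _ _ _)).symm := by
  subst hp
  simp [Bicategory.Strict.associator_eqToIso]

/-- A weighted cocone with vertex `X`, composed with a 1-cell `X ⟶ Y`. -/
def extend {X : K} (σ : WeightedCocone W F X) {Y : K} (h : X ⟶ Y) : WeightedCocone W F Y where
  app j := σ.app j ⋙ postcomp (F.obj j) h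
  nat_obj f x := (congrArg (· ≫ h) (σ.nat_obj f x)).trans (Bicategory.Strict.assoc _ _ _)
  nat_map f x y t := by
    change (σ.app _).map _ ▷ h = eqToHom _ ≫ F.map f ◁ ((σ.app _).map t ▷ h) ≫ eqToHom _
    simp [σ.nat_map, Bicategory.Strict.associator_eqToIso]
  nat_two {_ _ f g} α x :=
    strict_conj_whiskerRight _ _ h (σ.nat_obj f x) (σ.nat_obj g x) (σ.nat_two α x)

/-- For a weighted cocone with vertex `X`, the comparison functor
`K(X, Y) ⥤ [Jᵒᵖ, Cat](W, K(F -, Y))` given by composition with the cocone. -/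
def comparison {X : K} (σ : WeightedCocone W F X) (Y : K) : (X ⟶ Y) ⥤ WeightedCocone W F Y where
  obj h := σ.extend h
  map θ :=
    { app j := Functor.whiskerLeft (σ.app j) ((postcomposing (F.obj j) X Y).map θ)
      nat f x := strict_conj_whiskerLeft θ (σ.nat_obj f x) }
  map_id _ := Hom.ext (funext fun _ => NatTrans.ext (funext fun _ =>
    Bicategory.whiskerLeft_id _ _))
  map_comp _ _ := Hom.ext (funext fun _ => NatTrans.ext (funext fun _ =>
    Bicategory.whiskerLeft_comp _ _ _))

/-- A weighted cocone with vertex `X` exhibits `X` as the `W`-weighted 2-colimit of `F` if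
composition with it is, for every `Y`, an isomorphism of categories
`K(X, Y) ≅ [Jᵒᵖ, Cat](W, K(F -, Y))`. -/
def IsTwoColimit {X : K} (σ : WeightedCocone W F X) : Prop :=
  ∀ Y : K, (σ.comparison Y).IsIso

end WeightedCocone

/-- The 2-category `K` has finite 2-colimits: all `W`-weighted 2-colimits of 2-functors
`F : J → K` exist, where `J` is a 2-category with finitely many objects and finitely presented
hom-categories, and the values of the weight `W : Jᵒᵖ → Cat` are finitely presented. -/
def HasFiniteTwoColimits (K : Type u) [Bicategory.{w, v} K] [Bicategory.Strict K] : Prop :=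
  ∀ (J : Type uJ) [Bicategory.{wJ, vJ} J] [Bicategory.Strict J]
    (W : StrictPseudofunctor Jᵒᵖ Cat.{vW, uW}) (F : StrictPseudofunctor J K),
    Finite J → (∀ j k : J, IsFinitelyPresentedCategory (j ⟶ k)) →
    (∀ j : J, IsFinitelyPresentedCategory (W.obj (op j))) →
    ∃ (X : K) (σ : WeightedCocone W F X), σ.IsTwoColimit

end TwoColimits

/-!
The 2-colimit of a diagram `F` weighted by `W` represents weighted cocones, so it is enough to
present the cocones on `F` with vertex `X`, naturally in `X`, by finitely many generators and
relations, and to know that `Cat(E)` has internal categories presented in this way.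

*Presentations.* The left adjoint `hU` supplies free internal categories on internal graphs. To
impose an equation between two parallel families of arrows `u, v : T ⟶ C₁`, one closes the pair
under composition with arrows of `C` on both sides (`IsIdealPair`) and takes the coequaliser of the
closed pair as the new object of arrows. Objects, sources and targets do not change, and stability
of the coequaliser under pullback is exactly what makes composition descend
(`IsIdealPair.exists_mul`, `IsIdealPair.exists_quotient`). A condition on functors out of `C` is
called `Imposable` if it can be forced universally, even after a change of `C`; imposable
conditions are closed under finite conjunctions. For a map of graphs out of an internal category,
functoriality is imposable, which gives finite coproducts, coequalisers and free adjunctions of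
arrows (`exists_generated`, `Imposable.comp_eq`). Objects are identified already in the graph,
before the free category is taken, so nothing has to be known about the objects of a free category.

*Tensors.* For a finitely presented `W`, functors `W ⥤ Cat(E)(A, X)` are represented by an internal
category, built from copies of `A` indexed by the generating objects of `W`, one 2-cell for each
generating arrow, and one equation for each relation (`exists_tensor`).

*Weighted cocones.* A cocone is a family of functors `W(j) ⥤ Cat(E)(F j, X)` which is natural.
Naturality at a 1-cell `f : j ⟶ k` is an equality of two functors on `W(k)`, and naturality at all
2-cells, for given `x : W(k)`, is an equality of two functors on `J(j, k)` (`IsTwoNatural`). All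
these domains are finitely presented, so by the universal property of tensors each of these is one
equation between functors out of the coproduct of the tensors of `F j` with `W(j)`. There are
finitely many of them because `J` has finitely many 1-cells and each `W(k)` finitely many objects.

*The second dimension.* `Cat(E)` has powers by the arrow category (`exists_isArrowPower`), with
commutative squares as arrows. Hence 2-cells are 1-cells into a power, modifications are cocones
on a power, and bijectivity on objects of the comparison functors for all targets implies that they
are isomorphisms (`isTwoColimit_of_bijective`).
-/

section

attribute [local simp] pullback.lift_fst pullback.lift_snd pullback.lift_fst_assoc
  pullback.lift_snd_assoc

variable {E : Type u} [Category.{v} E] [HasPullbacks E]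

/-! ### Pullback-stable coequalisers -/

section Stable

variable [HasPullbackStableCoequalizers E]

attribute [instance] HasPullbackStableCoequalizers.hasCoequalizers

/-- The pullback of a coequaliser is again a coequaliser, with the total objects as apexes. -/
theorem exists_isColimit_pullback_coequalizer {R Y P : E} (p q : R ⟶ Y)
    (g : P ⟶ coequalizer p q) :
    ∃ (p' q' : pullback (p ≫ coequalizer.π p q) g ⟶ pullback (coequalizer.π p q) g)
      (w : p' ≫ pullback.snd _ _ = q' ≫ pullback.snd _ _),
      p' ≫ pullback.fst _ _ = pullback.fst _ _ ≫ p ∧ q' ≫ pullback.fst _ _ = pullback.fst _ _ ≫ q ∧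
      p' ≫ pullback.snd _ _ = pullback.snd _ _ ∧ q' ≫ pullback.snd _ _ = pullback.snd _ _ ∧
      Nonempty (IsColimit (Cofork.ofπ (pullback.snd (coequalizer.π p q) g) w)) := by
  let π := coequalizer.π p q
  let p₀ : Over.mk (p ≫ π) ⟶ Over.mk π := Over.homMk p rfl
  let q₀ : Over.mk (p ≫ π) ⟶ Over.mk π := Over.homMk q (coequalizer.condition p q).symm
  let π₀ : Over.mk π ⟶ Over.mk (𝟙 (coequalizer p q)) := Over.homMk π (Category.comp_id π)
  have w₀ : p₀ ≫ π₀ = q₀ ≫ π₀ := Over.OverMorphism.ext (coequalizer.condition p q)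
  let hc : IsColimit (Cofork.ofπ π₀ w₀) := Cofork.IsColimit.mk' _ fun s => by
    have hs : p ≫ s.π.left = q ≫ s.π.left := congrArg CommaMorphism.left s.condition
    refine ⟨Over.homMk (coequalizer.desc s.π.left hs) ?_, ?_, ?_⟩
    · apply coequalizer.hom_ext
      rw [coequalizer.π_desc_assoc]
      exact (Over.w s.π).trans (Category.comp_id π).symm
    · exact Over.OverMorphism.ext (coequalizer.π_desc _ _)
    · intro m hm
      apply Over.OverMorphism.ext
      apply coequalizer.hom_ext
      exact (congrArg CommaMorphism.left hm).trans (coequalizer.π_desc _ _).symm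
  have := HasPullbackStableCoequalizers.preserves g
  let h₁ := isColimitCoforkMapOfIsColimit (Over.pullback g) w₀ hc
  let h₂ := isColimitCoforkMapOfIsColimit (Over.forget P) _ h₁
  refine ⟨((Over.pullback g).map p₀).left, ((Over.pullback g).map q₀).left, ?_, ?_, ?_, ?_, ?_, ⟨?_⟩⟩
  · exact (pullback.lift_snd _ _ _).trans (pullback.lift_snd _ _ _).symm
  · exact pullback.lift_fst _ _ _
  · exact pullback.lift_fst _ _ _
  · exact pullback.lift_snd _ _ _
  · exact pullback.lift_snd _ _ _
  · have : IsIso (pullback.snd (𝟙 (coequalizer p q)) g) := pullback_snd_iso_of_left_iso _ _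
    let i := asIso (pullback.snd (𝟙 (coequalizer p q)) g)
    exact IsColimit.ofIsoColimit h₂ (Cofork.ext i (pullback.lift_snd _ _ _))

instance epi_pullback_snd_coequalizer {R Y P : E} (p q : R ⟶ Y) (g : P ⟶ coequalizer p q) :
    Epi (pullback.snd (coequalizer.π p q) g) := by
  obtain ⟨p', q', w, -, -, -, -, ⟨hc⟩⟩ := exists_isColimit_pullback_coequalizer p q g
  exact ⟨fun _ _ h => Cofork.IsColimit.hom_ext hc h⟩

/-- A map out of the pullback of a coequaliser descends along the projection as soon as it
coequalises all pairs of generalised elements with the same image. -/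
theorem exists_desc_pullback_coequalizer {R Y P : E} (p q : R ⟶ Y) (g : P ⟶ coequalizer p q)
    {Z : E} (m : pullback (coequalizer.π p q) g ⟶ Z)
    (hm : ∀ (T : E) (r : T ⟶ R) (a : T ⟶ P) (h : (r ≫ p) ≫ coequalizer.π p q = a ≫ g)
      (h' : (r ≫ q) ≫ coequalizer.π p q = a ≫ g),
      pullback.lift (r ≫ p) a h ≫ m = pullback.lift (r ≫ q) a h' ≫ m) :
    ∃ n : P ⟶ Z, pullback.snd (coequalizer.π p q) g ≫ n = m := by
  obtain ⟨p', q', w, hp, hq, hp', hq', ⟨hc⟩⟩ := exists_isColimit_pullback_coequalizer p q g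
  have hm' : p' ≫ m = q' ≫ m := by
    have h := hm _ (pullback.fst (p ≫ coequalizer.π p q) g) (pullback.snd _ _)
      (by rw [Category.assoc, pullback.condition])
      (by rw [Category.assoc, ← coequalizer.condition, pullback.condition])
    convert! h using 2 <;> apply pullback.hom_ext <;> simp [*]
  exact ⟨Cofork.IsColimit.desc hc m hm', Cofork.IsColimit.π_desc' hc m hm'⟩

/-- Generalised elements of a coequaliser lift locally. -/
theorem exists_epi_lift_coequalizer {R Y T : E} (p q : R ⟶ Y) (d : T ⟶ coequalizer p q) :
    ∃ (T' : E) (e : T' ⟶ T) (y : T' ⟶ Y), Epi e ∧ y ≫ coequalizer.π p q = e ≫ d :=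
  ⟨_, pullback.snd (coequalizer.π p q) d, pullback.fst _ _, inferInstance, pullback.condition⟩

end Stable

namespace InternalCategory

/-! ### Internal categories and functors in terms of generalised elements -/

/-- An internal category whose laws are verified on generalised elements. -/
def ofElements (G : InternalGraph E) (ident : G.vert ⟶ G.edge)
    (mul : pullback G.tgt G.src ⟶ G.edge)
    (ident_src : ident ≫ G.src = 𝟙 G.vert) (ident_tgt : ident ≫ G.tgt = 𝟙 G.vert)
    (mul_src : mul ≫ G.src = pullback.fst G.tgt G.src ≫ G.src)
    (mul_tgt : mul ≫ G.tgt = pullback.snd G.tgt G.src ≫ G.tgt)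
    (ident_mul : ∀ {T : E} (f : T ⟶ G.edge) (h : (f ≫ G.src ≫ ident) ≫ G.tgt = f ≫ G.src),
      pullback.lift (f ≫ G.src ≫ ident) f h ≫ mul = f)
    (mul_ident : ∀ {T : E} (f : T ⟶ G.edge) (h : f ≫ G.tgt = (f ≫ G.tgt ≫ ident) ≫ G.src),
      pullback.lift f (f ≫ G.tgt ≫ ident) h ≫ mul = f)
    (mul_assoc : ∀ {T : E} (f g k : T ⟶ G.edge) (hfg : f ≫ G.tgt = g ≫ G.src)
      (hgk : g ≫ G.tgt = k ≫ G.src)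
      (h₁ : (pullback.lift f g hfg ≫ mul) ≫ G.tgt = k ≫ G.src)
      (h₂ : f ≫ G.tgt = (pullback.lift g k hgk ≫ mul) ≫ G.src),
      pullback.lift (pullback.lift f g hfg ≫ mul) k h₁ ≫ mul =
        pullback.lift f (pullback.lift g k hgk ≫ mul) h₂ ≫ mul) :
    InternalCategory E where
  toInternalGraph := G
  ident := ident
  mul := mul
  ident_src := ident_src
  ident_tgt := ident_tgt
  mul_src := mul_src
  mul_tgt := mul_tgt
  ident_mul := by
    have h := ident_mul (𝟙 G.edge) (by simp [ident_tgt])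
    convert! h using 3
    simp
  mul_ident := by
    have h := mul_ident (𝟙 G.edge) (by simp [ident_src])
    convert! h using 3
    simp
  mul_assoc := by
    have h := mul_assoc
      (pullback.fst (pullback.snd G.tgt G.src ≫ G.tgt) G.src ≫ pullback.fst G.tgt G.src)
      (pullback.fst (pullback.snd G.tgt G.src ≫ G.tgt) G.src ≫ pullback.snd G.tgt G.src)
      (pullback.snd (pullback.snd G.tgt G.src ≫ G.tgt) G.src)
      (by simp [pullback.condition]) (by simp [pullback.condition])
      (by simp [mul_tgt, pullback.condition]) (by simp [mul_src, pullback.condition])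
    have e : pullback.lift
        (pullback.fst (pullback.snd G.tgt G.src ≫ G.tgt) G.src ≫ pullback.fst G.tgt G.src)
        (pullback.fst (pullback.snd G.tgt G.src ≫ G.tgt) G.src ≫ pullback.snd G.tgt G.src)
        (by simp [pullback.condition]) = pullback.fst _ _ := by
      apply pullback.hom_ext <;> simp
    simp only [e] at h
    exact h

theorem cmp_fst_snd (A : InternalCategory E) :
    A.cmp (pullback.fst A.tgt A.src) (pullback.snd A.tgt A.src) pullback.condition = A.mul := by
  have : pullback.lift (pullback.fst A.tgt A.src) (pullback.snd A.tgt A.src) pullback.condition =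
      𝟙 _ := by apply pullback.hom_ext <;> simp
  rw [cmp, this, Category.id_comp]

/-- A morphism of graphs preserving identities and composites of generalised elements is an
internal functor. -/
def funOfElements {A B : InternalCategory E}
    (F : InternalGraph.Hom A.toInternalGraph B.toInternalGraph)
    (hi : A.ident ≫ F.onEdge = F.onVert ≫ B.ident)
    (hm : ∀ {T : E} (f g : T ⟶ A.edge) (h : f ≫ A.tgt = g ≫ A.src)
      (h' : (f ≫ F.onEdge) ≫ B.tgt = (g ≫ F.onEdge) ≫ B.src),
      A.cmp f g h ≫ F.onEdge = B.cmp (f ≫ F.onEdge) (g ≫ F.onEdge) h') : Fun A B where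
  toHom := F
  ident_comm := hi
  mul_comm := by
    conv_lhs => rw [← A.cmp_fst_snd]
    exact hm _ _ _ _

theorem Fun.comp_assoc {A B C D : InternalCategory E} (F : Fun A B) (G : Fun B C) (H : Fun C D) :
    (F.comp G).comp H = F.comp (G.comp H) :=
  Fun.ext' (Category.assoc _ _ _) (Category.assoc _ _ _)

theorem Fun.id_comp {A B : InternalCategory E} (F : Fun A B) : (Fun.id A).comp F = F :=
  Fun.ext' (Category.id_comp _) (Category.id_comp _)

theorem Fun.congr_onVert {A B : InternalCategory E} {F G : Fun A B} (h : F = G) :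
    F.onVert = G.onVert := by rw [h]

theorem Fun.congr_onEdge {A B : InternalCategory E} {F G : Fun A B} (h : F = G) :
    F.onEdge = G.onEdge := by rw [h]

@[simp]
theorem Fun.comp_onEdge {A B C : InternalCategory E} (F : Fun A B) (G : Fun B C) :
    (F.comp G).onEdge = F.onEdge ≫ G.onEdge := rfl

@[simp]
theorem Fun.comp_onVert {A B C : InternalCategory E} (F : Fun A B) (G : Fun B C) :
    (F.comp G).onVert = F.onVert ≫ G.onVert := rfl

end InternalCategory

end

section

attribute [local simp] pullback.lift_fst pullback.lift_snd pullback.lift_fst_assoc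
  pullback.lift_snd_assoc

variable {E : Type u} [Category.{v} E] [HasPullbacks E]

namespace InternalCategory

/-! ### Quotients by relations between parallel arrows -/

/-- A pair of families of arrows `p, q : R ⟶ C₁` indexed by `R` is an ideal pair if it is
parallel and if composing it with a further arrow on either side gives, locally in the index, a
pair of the same family. -/
structure IsIdealPair (C : InternalCategory E) {R : E} (p q : R ⟶ C.edge) : Prop where
  src : p ≫ C.src = q ≫ C.src
  tgt : p ≫ C.tgt = q ≫ C.tgt
  left {T : E} (c : T ⟶ C.edge) (r : T ⟶ R) (h : c ≫ C.tgt = (r ≫ p) ≫ C.src)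
    (h' : c ≫ C.tgt = (r ≫ q) ≫ C.src) :
    ∃ r' : T ⟶ R, r' ≫ p = C.cmp c (r ≫ p) h ∧ r' ≫ q = C.cmp c (r ≫ q) h'
  right {T : E} (r : T ⟶ R) (c : T ⟶ C.edge) (h : (r ≫ p) ≫ C.tgt = c ≫ C.src)
    (h' : (r ≫ q) ≫ C.tgt = c ≫ C.src) :
    ∃ r' : T ⟶ R, r' ≫ p = C.cmp (r ≫ p) c h ∧ r' ≫ q = C.cmp (r ≫ q) c h'

/-- A parallel pair of families of arrows generates an ideal pair, indexed by the triples
`(a, t, b)` for which the composites `a · u t · b` and `a · v t · b` are defined. -/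
theorem exists_isIdealPair (C : InternalCategory E) {T : E} (u v : T ⟶ C.edge)
    (hs : u ≫ C.src = v ≫ C.src) (ht : u ≫ C.tgt = v ≫ C.tgt) :
    ∃ (R : E) (p q : R ⟶ C.edge), C.IsIdealPair p q ∧ (∃ r : T ⟶ R, r ≫ p = u ∧ r ≫ q = v) ∧
      ∀ (X : InternalCategory E) (h : Fun C X), u ≫ h.onEdge = v ≫ h.onEdge →
        p ≫ h.onEdge = q ≫ h.onEdge := by
  obtain ⟨R, a, t, b, hat, htb, lift⟩ : ∃ (R : E) (a : R ⟶ C.edge) (t : R ⟶ T) (b : R ⟶ C.edge),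
      a ≫ C.tgt = (t ≫ u) ≫ C.src ∧ (t ≫ u) ≫ C.tgt = b ≫ C.src ∧
      ∀ {X : E} (a' : X ⟶ C.edge) (t' : X ⟶ T) (b' : X ⟶ C.edge)
        (_ : a' ≫ C.tgt = (t' ≫ u) ≫ C.src) (_ : (t' ≫ u) ≫ C.tgt = b' ≫ C.src),
        ∃ r : X ⟶ R, r ≫ a = a' ∧ r ≫ t = t' ∧ r ≫ b = b' := by
    refine ⟨pullback C.tgt (pullback.fst (u ≫ C.tgt) C.src ≫ u ≫ C.src), pullback.fst _ _,
      pullback.snd _ _ ≫ pullback.fst _ _, pullback.snd _ _ ≫ pullback.snd _ _, ?_, ?_, ?_⟩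
    · simp only [Category.assoc]; exact pullback.condition
    · simp only [Category.assoc]; rw [pullback.condition]
    · exact fun a' t' b' h₁ h₂ =>
        ⟨pullback.lift a' (pullback.lift t' b' (by simpa using h₂)) (by simpa using h₁),
          by simp, by simp, by simp⟩
  have hat' : a ≫ C.tgt = (t ≫ v) ≫ C.src := by rw [hat, Category.assoc, hs, Category.assoc]
  have htb' : (t ≫ v) ≫ C.tgt = b ≫ C.src := by rw [← htb, Category.assoc, ← ht, Category.assoc]
  refine ⟨R, C.cmp a (C.cmp (t ≫ u) b htb) (by rw [cmp_src, hat]),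
    C.cmp a (C.cmp (t ≫ v) b htb') (by rw [cmp_src, hat']), ⟨?_, ?_, ?_, ?_⟩, ?_, ?_⟩
  · simp only [cmp_src]
  · simp only [cmp_tgt]
  · intro X c r h h'
    have hc : c ≫ C.tgt = (r ≫ a) ≫ C.src := by
      simp only [h, Category.assoc, cmp_src]
    obtain ⟨r', ha, ht', hb⟩ := lift (C.cmp c (r ≫ a) hc) (r ≫ t) (r ≫ b)
      (by rw [cmp_tgt, Category.assoc, hat]; simp only [Category.assoc])
      (by simpa only [Category.assoc] using congrArg (r ≫ ·) htb)
    have e : ∀ (w : T ⟶ C.edge) (h₁ : a ≫ C.tgt = (t ≫ w) ≫ C.src)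
        (h₂ : (t ≫ w) ≫ C.tgt = b ≫ C.src)
        (h₃ : c ≫ C.tgt = (r ≫ C.cmp a (C.cmp (t ≫ w) b h₂) (by rw [cmp_src, h₁])) ≫ C.src),
        r' ≫ C.cmp a (C.cmp (t ≫ w) b h₂) (by rw [cmp_src, h₁]) =
          C.cmp c (r ≫ C.cmp a (C.cmp (t ≫ w) b h₂) (by rw [cmp_src, h₁])) h₃ := by
      intro w h₁ h₂ h₃
      simp only [comp_cmp, ← Category.assoc, ha, ht', hb]
      exact C.cmp_assoc _ _ _ _ _
    exact ⟨r', e u hat htb h, e v hat' htb' h'⟩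
  · intro X r c h h'
    have hc : (r ≫ b) ≫ C.tgt = c ≫ C.src := by
      simp only [← h, Category.assoc, cmp_tgt]
    obtain ⟨r', ha, ht', hb⟩ := lift (r ≫ a) (r ≫ t) (C.cmp (r ≫ b) c hc)
      (by simpa only [Category.assoc] using congrArg (r ≫ ·) hat)
      (by rw [cmp_src]; simpa only [Category.assoc] using congrArg (r ≫ ·) htb)
    have e : ∀ (w : T ⟶ C.edge) (h₁ : a ≫ C.tgt = (t ≫ w) ≫ C.src)
        (h₂ : (t ≫ w) ≫ C.tgt = b ≫ C.src)
        (h₃ : (r ≫ C.cmp a (C.cmp (t ≫ w) b h₂) (by rw [cmp_src, h₁])) ≫ C.tgt = c ≫ C.src),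
        r' ≫ C.cmp a (C.cmp (t ≫ w) b h₂) (by rw [cmp_src, h₁]) =
          C.cmp (r ≫ C.cmp a (C.cmp (t ≫ w) b h₂) (by rw [cmp_src, h₁])) c h₃ := by
      intro w h₁ h₂ h₃
      simp only [comp_cmp, ← Category.assoc, ha, ht', hb]
      rw [C.cmp_assoc]
      · refine C.cmp_congr rfl ?_ _
        rw [C.cmp_assoc]
      · simpa only [cmp_tgt] using hc
    exact ⟨r', e u hat htb h, e v hat' htb' h'⟩
  · obtain ⟨r, ha, ht', hb⟩ := lift ((u ≫ C.src) ≫ C.ident) (𝟙 T) ((u ≫ C.tgt) ≫ C.ident)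
      (by simp [C.ident_tgt]) (by simp [C.ident_src])
    have e : ∀ (w : T ⟶ C.edge) (h₁ : a ≫ C.tgt = (t ≫ w) ≫ C.src)
        (h₂ : (t ≫ w) ≫ C.tgt = b ≫ C.src) (_ : u ≫ C.src = w ≫ C.src)
        (_ : u ≫ C.tgt = w ≫ C.tgt),
        r ≫ C.cmp a (C.cmp (t ≫ w) b h₂) (by rw [cmp_src, h₁]) = w := by
      intro w h₁ h₂ h₃ h₄
      simp only [comp_cmp, ← Category.assoc, ha, ht', hb]
      rw [C.ident_cmp]
      · rw [C.cmp_ident] <;> simp [h₄]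
      · rw [cmp_src]; simp [h₃]
    exact ⟨r, e u hat htb rfl rfl, e v hat' htb' hs ht⟩
  · intro X h huv
    simp only [Fun.cmp_comp, Category.assoc, huv]

variable [HasPullbackStableCoequalizers E]

/-- The composition of an internal category descends to the quotient of its object of arrows by
an ideal pair. Pullback stability is used twice, to make each of the two factors descend. -/
theorem IsIdealPair.exists_mul {C : InternalCategory E} {R : E} {p q : R ⟶ C.edge}
    (I : C.IsIdealPair p q) (s t : coequalizer p q ⟶ C.vert)
    (hs : coequalizer.π p q ≫ s = C.src) (ht : coequalizer.π p q ≫ t = C.tgt) :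
    ∃ m : pullback t s ⟶ coequalizer p q, ∀ {T : E} (x y : T ⟶ C.edge)
      (h : x ≫ C.tgt = y ≫ C.src)
      (h' : (x ≫ coequalizer.π p q) ≫ t = (y ≫ coequalizer.π p q) ≫ s),
      pullback.lift (x ≫ coequalizer.π p q) (y ≫ coequalizer.π p q) h' ≫ m =
        C.cmp x y h ≫ coequalizer.π p q := by
  obtain ⟨n, hn⟩ : ∃ n : pullback C.tgt s ⟶ coequalizer p q, ∀ {T : E} (x y : T ⟶ C.edge)
      (h : x ≫ C.tgt = y ≫ C.src) (h' : x ≫ C.tgt = (y ≫ (coequalizer.π p q)) ≫ s),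
      pullback.lift x (y ≫ (coequalizer.π p q)) h' ≫ n = C.cmp x y h ≫ (coequalizer.π p q) := by
    have hc : (pullback.snd (coequalizer.π p q) (pullback.snd C.tgt s) ≫ pullback.fst C.tgt s) ≫ C.tgt =
        pullback.fst (coequalizer.π p q) (pullback.snd C.tgt s) ≫ C.src := by
      rw [Category.assoc, pullback.condition, ← hs, ← pullback.condition_assoc]
    obtain ⟨n, hn⟩ := exists_desc_pullback_coequalizer p q (pullback.snd C.tgt s)
      (C.cmp _ _ hc ≫ (coequalizer.π p q)) (by
        intro T r a h h'
        simp only [comp_cmp, ← Category.assoc]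
        have e₁ : (a ≫ pullback.fst C.tgt s) ≫ C.tgt = (r ≫ p) ≫ C.src := by
          rw [Category.assoc, pullback.condition, ← Category.assoc, ← h, Category.assoc, hs]
        have e₂ : (a ≫ pullback.fst C.tgt s) ≫ C.tgt = (r ≫ q) ≫ C.src := by
          rw [Category.assoc, pullback.condition, ← Category.assoc, ← h', Category.assoc, hs]
        obtain ⟨r', h₁, h₂⟩ := I.left _ r e₁ e₂
        have := congrArg (r' ≫ ·) (coequalizer.condition p q)
        simp only [← Category.assoc, h₁, h₂] at this
        simpa using this)
    refine ⟨n, fun {T} x y h h' => ?_⟩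
    have := congrArg (pullback.lift y (pullback.lift x (y ≫ (coequalizer.π p q)) h') (by simp) ≫ ·) hn
    simp only [← Category.assoc, comp_cmp, pullback.lift_snd, pullback.lift_fst] at this
    exact this
  obtain ⟨m, hm⟩ := exists_desc_pullback_coequalizer p q (pullback.fst t s)
      (pullback.lift (pullback.fst (coequalizer.π p q) (pullback.fst t s))
        (pullback.snd (coequalizer.π p q) (pullback.fst t s) ≫ pullback.snd t s)
        (by rw [← ht, pullback.condition_assoc, pullback.condition, Category.assoc]) ≫ n) (by
      intro T r a h h'
      obtain ⟨T', e, y, he, hy⟩ := exists_epi_lift_coequalizer p q (a ≫ pullback.snd t s)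
      rw [← cancel_epi e]
      have e₁ : ((e ≫ r) ≫ p) ≫ C.tgt = y ≫ C.src := by
        rw [← hs, reassoc_of% hy, ← pullback.condition, ← reassoc_of% h, ht]
        simp only [Category.assoc]
      have e₂ : ((e ≫ r) ≫ q) ≫ C.tgt = y ≫ C.src := by
        simpa only [Category.assoc, I.tgt] using e₁
      have f₁ : ((e ≫ r) ≫ p) ≫ C.tgt = (y ≫ (coequalizer.π p q)) ≫ s := by rw [e₁, Category.assoc, hs]
      have f₂ : ((e ≫ r) ≫ q) ≫ C.tgt = (y ≫ (coequalizer.π p q)) ≫ s := by rw [e₂, Category.assoc, hs]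
      obtain ⟨r', h₁, h₂⟩ := I.right _ y e₁ e₂
      have key := congrArg (r' ≫ ·) (coequalizer.condition p q)
      simp only [← Category.assoc, h₁, h₂] at key
      rw [← hn _ _ e₁ f₁, ← hn _ _ e₂ f₂] at key
      simp only [← Category.assoc]
      convert! key using 2 <;> apply pullback.hom_ext <;> simp [hy])
  refine ⟨m, fun {T} x y h h' => ?_⟩
  have := congrArg (pullback.lift x (pullback.lift (x ≫ (coequalizer.π p q)) (y ≫ (coequalizer.π p q)) h') (by simp) ≫ ·) hm
  simp only [← Category.assoc] at this
  rw [pullback.lift_snd] at this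
  rw [this, ← hn x y h (by rw [h, Category.assoc, hs])]
  congr 1
  apply pullback.hom_ext <;> simp

end InternalCategory

end

section

variable {E : Type u} [Category.{v} E] [HasPullbacks E]

namespace InternalCategory

/-- The quotient of an internal category by an ideal pair. It has the same objects, and its
object of arrows is the coequaliser of the pair. -/
theorem IsIdealPair.exists_quotient [HasPullbackStableCoequalizers E] {C : InternalCategory E}
    {R : E} {p q : R ⟶ C.edge} (I : C.IsIdealPair p q) :
    ∃ (Q : InternalCategory E) (π : Fun C Q),
      (∀ {X : InternalCategory E} (k k' : Fun Q X), π.comp k = π.comp k' → k = k') ∧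
      ∀ {X : InternalCategory E} (h : Fun C X),
        p ≫ h.onEdge = q ≫ h.onEdge ↔ ∃ k : Fun Q X, π.comp k = h := by
  let s : coequalizer p q ⟶ C.vert := coequalizer.desc C.src I.src
  let t : coequalizer p q ⟶ C.vert := coequalizer.desc C.tgt I.tgt
  have hs : coequalizer.π p q ≫ s = C.src := coequalizer.π_desc _ _
  have ht : coequalizer.π p q ≫ t = C.tgt := coequalizer.π_desc _ _
  obtain ⟨m, hm⟩ := I.exists_mul s t hs ht
  -- Every law of `Q` is checked after a cover over which the arrows involved lift to `C`.
  have lift : ∀ {T : E} (x : T ⟶ coequalizer p q), ∃ (T' : E) (e : T' ⟶ T) (y : T' ⟶ C.edge),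
      Epi e ∧ y ≫ coequalizer.π p q = e ≫ x := fun x => exists_epi_lift_coequalizer p q x
  have lift₂ : ∀ {T : E} (f g : T ⟶ coequalizer p q) (_ : f ≫ t = g ≫ s),
      ∃ (T' : E) (e : T' ⟶ T) (x y : T' ⟶ C.edge), Epi e ∧ x ≫ coequalizer.π p q = e ≫ f ∧
        y ≫ coequalizer.π p q = e ≫ g ∧ x ≫ C.tgt = y ≫ C.src := by
    intro T f g hfg
    obtain ⟨T₁, e₁, x, _, hx⟩ := lift f
    obtain ⟨T₂, e₂, y, _, hy⟩ := lift (e₁ ≫ g)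
    refine ⟨T₂, e₂ ≫ e₁, e₂ ≫ x, y, epi_comp _ _, by simp [hx], by simp [hy], ?_⟩
    rw [← hs, reassoc_of% hy, ← hfg, ← reassoc_of% hx, ht, Category.assoc]
  have lift₃ : ∀ {T : E} (f g k : T ⟶ coequalizer p q) (_ : f ≫ t = g ≫ s) (_ : g ≫ t = k ≫ s),
      ∃ (T' : E) (e : T' ⟶ T) (x y z : T' ⟶ C.edge), Epi e ∧ x ≫ coequalizer.π p q = e ≫ f ∧
        y ≫ coequalizer.π p q = e ≫ g ∧ z ≫ coequalizer.π p q = e ≫ k ∧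
        x ≫ C.tgt = y ≫ C.src ∧ y ≫ C.tgt = z ≫ C.src := by
    intro T f g k hfg hgk
    obtain ⟨T₁, e₁, x, y, _, hx, hy, hxy⟩ := lift₂ f g hfg
    obtain ⟨T₂, e₂, z, _, hz⟩ := lift (e₁ ≫ k)
    refine ⟨T₂, e₂ ≫ e₁, e₂ ≫ x, e₂ ≫ y, z, epi_comp _ _, by simp [hx], by simp [hy],
      by simp [hz], by simp [hxy], ?_⟩
    rw [← hs, reassoc_of% hz, ← hgk, ← reassoc_of% hy, ht, Category.assoc]
  have hm' : ∀ {T T' : E} (e : T' ⟶ T) (f g : T ⟶ coequalizer p q) (h : f ≫ t = g ≫ s)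
      (x y : T' ⟶ C.edge) (hx : x ≫ coequalizer.π p q = e ≫ f)
      (hy : y ≫ coequalizer.π p q = e ≫ g) (hxy : x ≫ C.tgt = y ≫ C.src),
      e ≫ pullback.lift f g h ≫ m = C.cmp x y hxy ≫ coequalizer.π p q := by
    intro T T' e f g h x y hx hy hxy
    rw [← hm x y hxy (by rw [Category.assoc, ht, Category.assoc, hs, hxy]), ← Category.assoc,
      pullback_comp_lift e f g h hx.symm hy.symm]
  have hms : ∀ {T : E} (f g : T ⟶ coequalizer p q) (h : f ≫ t = g ≫ s),
      pullback.lift f g h ≫ m ≫ s = f ≫ s := by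
    intro T f g h
    obtain ⟨T', e, x, y, _, hx, hy, hxy⟩ := lift₂ f g h
    rw [← cancel_epi e, ← reassoc_of% hx, hs, ← C.cmp_src x y hxy, ← hs, ← Category.assoc (C.cmp _ _ _),
      ← hm' e f g h x y hx hy hxy]
    simp only [Category.assoc]
  have hmt : ∀ {T : E} (f g : T ⟶ coequalizer p q) (h : f ≫ t = g ≫ s),
      pullback.lift f g h ≫ m ≫ t = g ≫ t := by
    intro T f g h
    obtain ⟨T', e, x, y, _, hx, hy, hxy⟩ := lift₂ f g h
    rw [← cancel_epi e, ← reassoc_of% hy, ht, ← C.cmp_tgt x y hxy, ← ht, ← Category.assoc (C.cmp _ _ _),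
      ← hm' e f g h x y hx hy hxy]
    simp only [Category.assoc]
  let Q : InternalCategory E := ofElements ⟨C.vert, coequalizer p q, s, t⟩
    (C.ident ≫ coequalizer.π p q) m
    (by rw [Category.assoc, hs, C.ident_src]) (by rw [Category.assoc, ht, C.ident_tgt])
    (by simpa using hms (pullback.fst t s) (pullback.snd t s) pullback.condition)
    (by simpa using hmt (pullback.fst t s) (pullback.snd t s) pullback.condition)
    (by
      intro T f h
      obtain ⟨T', e, x, _, hx⟩ := lift f
      rw [← cancel_epi e, hm' e _ f h ((x ≫ C.src) ≫ C.ident) x ?_ hx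
        (by simp [C.ident_tgt]), C.ident_cmp _ _ rfl, hx]
      simp only [← Category.assoc, ← hx, ← hs])
    (by
      intro T f h
      obtain ⟨T', e, x, _, hx⟩ := lift f
      rw [← cancel_epi e, hm' e f _ h x ((x ≫ C.tgt) ≫ C.ident) hx ?_
        (by simp [C.ident_src]), C.cmp_ident _ _ rfl, hx]
      simp only [← Category.assoc, ← hx, ← ht])
    (by
      intro T f g k hfg hgk h₁ h₂
      obtain ⟨T', e, x, y, z, _, hx, hy, hz, hxy, hyz⟩ := lift₃ f g k hfg hgk
      rw [← cancel_epi e, hm' e _ k h₁ (C.cmp x y hxy) z (hm' e f g hfg x y hx hy hxy).symm hz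
        (by rw [cmp_tgt, hyz]), hm' e f _ h₂ x (C.cmp y z hyz) hx
        (hm' e g k hgk y z hy hz hyz).symm (by rw [cmp_src, hxy]), C.cmp_assoc x y z hxy hyz])
  let π : Fun C Q := funOfElements
    ⟨𝟙 _, coequalizer.π p q, hs.trans (Category.comp_id _).symm, ht.trans (Category.comp_id _).symm⟩
    (Category.id_comp _).symm (fun f g h h' => (hm f g h h').symm)
  refine ⟨Q, π, ?_, ?_⟩
  · intro X k k' hk
    refine Fun.ext' ?_ (coequalizer.hom_ext (congrArg (fun F => F.onEdge) hk))
    have : 𝟙 C.vert ≫ k.onVert = 𝟙 C.vert ≫ k'.onVert := congrArg (fun F => F.onVert) hk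
    exact (Category.id_comp _).symm.trans (this.trans (Category.id_comp _))
  · intro X h
    constructor
    · intro hpq
      have hd : coequalizer.π p q ≫ coequalizer.desc h.onEdge hpq = h.onEdge :=
        coequalizer.π_desc _ _
      have es : coequalizer.desc h.onEdge hpq ≫ X.src = s ≫ h.onVert := by
        apply coequalizer.hom_ext
        rw [reassoc_of% hd, h.src_comm, reassoc_of% hs]
      have et : coequalizer.desc h.onEdge hpq ≫ X.tgt = t ≫ h.onVert := by
        apply coequalizer.hom_ext
        rw [reassoc_of% hd, h.tgt_comm, reassoc_of% ht]
      have ei : (C.ident ≫ coequalizer.π p q) ≫ coequalizer.desc h.onEdge hpq =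
          h.onVert ≫ X.ident := by
        rw [Category.assoc, hd, h.ident_comm]
      have em : ∀ {T : E} (f g : T ⟶ coequalizer p q) (hfg : f ≫ t = g ≫ s)
          (h' : (f ≫ coequalizer.desc h.onEdge hpq) ≫ X.tgt =
            (g ≫ coequalizer.desc h.onEdge hpq) ≫ X.src),
          (pullback.lift f g hfg ≫ m) ≫ coequalizer.desc h.onEdge hpq =
            X.cmp (f ≫ coequalizer.desc h.onEdge hpq) (g ≫ coequalizer.desc h.onEdge hpq) h' := by
        intro T f g hfg h'
        obtain ⟨T', e, x, y, _, hx, hy, hxy⟩ := lift₂ f g hfg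
        rw [← cancel_epi e, ← Category.assoc, hm' e f g hfg x y hx hy hxy, Category.assoc, hd,
          h.cmp_comp, comp_cmp]
        refine X.cmp_congr ?_ ?_ _
        · rw [← reassoc_of% hx, hd]
        · rw [← reassoc_of% hy, hd]
      exact ⟨funOfElements ⟨h.onVert, coequalizer.desc h.onEdge hpq, es, et⟩ ei em,
        Fun.ext' (Category.id_comp _) hd⟩
    · rintro ⟨k, rfl⟩
      exact coequalizer.condition_assoc p q k.onEdge

/-- A condition on internal functors out of `C` is imposable if, for every functor `u : C ⟶ D`,
the functors `h` out of `D` such that `u ≫ h` satisfies the condition are those which factor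
through a certain epimorphism `D ⟶ Q`. -/
def Imposable {C : InternalCategory E} (S : ∀ ⦃X : InternalCategory E⦄, Fun C X → Prop) : Prop :=
  ∀ ⦃D : InternalCategory E⦄ (u : Fun C D), ∃ (Q : InternalCategory E) (q : Fun D Q),
    (∀ {X : InternalCategory E} (k k' : Fun Q X), q.comp k = q.comp k' → k = k') ∧
    ∀ {X : InternalCategory E} (h : Fun D X), S (u.comp h) ↔ ∃ k : Fun Q X, q.comp k = h

namespace Imposable

variable {C : InternalCategory E}

theorem exists_quotient {S : ∀ ⦃X : InternalCategory E⦄, Fun C X → Prop} (hS : Imposable S) :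
    ∃ (Q : InternalCategory E) (q : Fun C Q),
      (∀ {X : InternalCategory E} (k k' : Fun Q X), q.comp k = q.comp k' → k = k') ∧
      ∀ {X : InternalCategory E} (h : Fun C X), S h ↔ ∃ k : Fun Q X, q.comp k = h := by
  simpa only [Fun.id_comp] using hS (Fun.id C)

theorem and {S S' : ∀ ⦃X : InternalCategory E⦄, Fun C X → Prop} (hS : Imposable S)
    (hS' : Imposable S') : Imposable fun _ h => S h ∧ S' h := by
  intro D u
  obtain ⟨Q, q, hq, hqS⟩ := hS u
  obtain ⟨Q', q', hq', hqS'⟩ := hS' (u.comp q)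
  refine ⟨Q', q.comp q', fun k k' hk => hq' _ _ (hq _ _ ?_), fun h => ⟨?_, ?_⟩⟩
  · rwa [Fun.comp_assoc, Fun.comp_assoc] at hk
  · rintro ⟨h₁, h₂⟩
    obtain ⟨k, rfl⟩ := (hqS h).1 h₁
    obtain ⟨k, rfl⟩ := (hqS' k).1 (by rwa [Fun.comp_assoc])
    exact ⟨k, Fun.comp_assoc _ _ _⟩
  · rintro ⟨k, rfl⟩
    refine ⟨(hqS _).2 ⟨q'.comp k, (Fun.comp_assoc _ _ _).symm⟩, ?_⟩
    have := (hqS' _).2 ⟨k, rfl⟩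
    rwa [Fun.comp_assoc, ← Fun.comp_assoc q] at this

theorem congr {S S' : ∀ ⦃X : InternalCategory E⦄, Fun C X → Prop} (hS : Imposable S)
    (h : ∀ ⦃X⦄ (k : Fun C X), S k ↔ S' k) : Imposable S' := by
  have : S = S' := by
    funext X k
    exact propext (h k)
  rwa [← this]

theorem trivially : Imposable (C := C) fun _ _ => True := fun D _ =>
  ⟨D, Fun.id D, fun k k' h => by rwa [Fun.id_comp, Fun.id_comp] at h,
    fun h => ⟨fun _ => ⟨h, Fun.id_comp h⟩, fun _ => trivial⟩⟩

theorem forall_finite {ι : Type*} [Finite ι]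
    {S : ι → ∀ ⦃X : InternalCategory E⦄, Fun C X → Prop} (hS : ∀ i, Imposable (S i)) :
    Imposable fun _ h => ∀ i, S i h := by
  have key : ∀ s : Set ι, s.Finite → Imposable fun _ h => ∀ i ∈ s, S i h := fun s hs => by
    induction s, hs using Set.Finite.induction_on with
    | empty => exact trivially.congr fun X k => by simp
    | @insert i _ _ _ ih => exact ((hS i).and ih).congr fun X k => by simp
  exact (key Set.univ Set.finite_univ).congr fun X k => by simp

/-- Equality of the images of two parallel families of arrows is imposable. -/
theorem onEdge_eq [HasPullbackStableCoequalizers E] {T : E} (u v : T ⟶ C.edge)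
    (hs : u ≫ C.src = v ≫ C.src) (ht : u ≫ C.tgt = v ≫ C.tgt) :
    Imposable (C := C) fun _ h => u ≫ h.onEdge = v ≫ h.onEdge := by
  intro D w
  obtain ⟨R, p, q, I, ⟨r, hp, hq⟩, hpq⟩ := D.exists_isIdealPair (u ≫ w.onEdge) (v ≫ w.onEdge)
    (by simp only [Category.assoc, w.src_comm, reassoc_of% hs])
    (by simp only [Category.assoc, w.tgt_comm, reassoc_of% ht])
  obtain ⟨Q, π, hπ, hQ⟩ := I.exists_quotient
  refine ⟨Q, π, hπ, fun h => ⟨fun huv => (hQ h).1 (hpq _ h ?_), fun hk => ?_⟩⟩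
  · simpa using huv
  · have := (hQ h).2 hk
    have := congrArg (r ≫ ·) this
    simpa [← Category.assoc, hp, hq] using this

end Imposable

end InternalCategory

end

section

attribute [local simp] coprod.inl_desc coprod.inr_desc coprod.inl_desc_assoc coprod.inr_desc_assoc

variable {E : Type u} [Category.{v} E] [HasPullbacks E]

namespace InternalCategory

/-! ### Internal categories given by generators and relations -/

/-- The free internal category on an internal graph. Its object of objects need not be the object
of vertices of the graph. -/
theorem exists_free (hU : (forgetToGraph E).IsRightAdjoint) (G : InternalGraph E) :
    ∃ (C : InternalCategory E) (n : InternalGraph.Hom G C.toInternalGraph),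
      ∀ {X : InternalCategory E} (g : InternalGraph.Hom G X.toInternalGraph), ∃! h : Fun C X,
        n.onVert ≫ h.onVert = g.onVert ∧ n.onEdge ≫ h.onEdge = g.onEdge := by
  let adj := Adjunction.ofIsRightAdjoint (forgetToGraph E)
  have key : ∀ {X : InternalCategory E} (h : (forgetToGraph E).leftAdjoint.obj G ⟶ X)
      (g : G ⟶ (forgetToGraph E).obj X), (adj.homEquiv G X) h = g ↔
        (InternalGraph.Hom.onVert (adj.unit.app G) ≫ (Fun.toHom h).onVert = InternalGraph.Hom.onVert g ∧
          InternalGraph.Hom.onEdge (adj.unit.app G) ≫ (Fun.toHom h).onEdge =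
            InternalGraph.Hom.onEdge g) := by
    intro X h g
    rw [Adjunction.homEquiv_unit]
    exact InternalGraph.Hom.ext_iff
  refine ⟨(forgetToGraph E).leftAdjoint.obj G, adj.unit.app G, fun {X} g =>
    ⟨(adj.homEquiv G X).symm g, (key _ g).1 (Equiv.apply_symm_apply _ _), fun h hh => ?_⟩⟩
  exact (Equiv.eq_symm_apply _).2 ((key h g).2 hh)

variable [HasPullbackStableCoequalizers E]

/-- Given a morphism of graphs from an internal category `A` to an internal category `C`, it is
imposable on a functor out of `C` that the composite be a functor out of `A`. -/
theorem Imposable.isFunctor {A C : InternalCategory E}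
    (m : InternalGraph.Hom A.toInternalGraph C.toInternalGraph) :
    Imposable fun (X : InternalCategory E) (h : Fun C X) =>
      ∃ F : Fun A X, F.onVert = m.onVert ≫ h.onVert ∧ F.onEdge = m.onEdge ≫ h.onEdge := by
  have hc : (pullback.fst A.tgt A.src ≫ m.onEdge) ≫ C.tgt =
      (pullback.snd A.tgt A.src ≫ m.onEdge) ≫ C.src := by
    rw [Category.assoc, m.tgt_comm, pullback.condition_assoc, Category.assoc, m.src_comm]
  refine Imposable.congr ((Imposable.onEdge_eq (A.ident ≫ m.onEdge) (m.onVert ≫ C.ident)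
    ?_ ?_).and (Imposable.onEdge_eq (A.mul ≫ m.onEdge) (C.cmp _ _ hc) ?_ ?_)) ?_
  · rw [Category.assoc, m.src_comm, reassoc_of% A.ident_src, Category.assoc, C.ident_src,
      Category.comp_id]
  · rw [Category.assoc, m.tgt_comm, reassoc_of% A.ident_tgt, Category.assoc, C.ident_tgt,
      Category.comp_id]
  · rw [Category.assoc, m.src_comm, reassoc_of% A.mul_src, cmp_src, Category.assoc, m.src_comm]
  · rw [Category.assoc, m.tgt_comm, reassoc_of% A.mul_tgt, cmp_tgt, Category.assoc, m.tgt_comm]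
  · intro X h
    have e₂ : A.mul ≫ m.onEdge ≫ h.onEdge = C.cmp _ _ hc ≫ h.onEdge ↔
        A.mul ≫ m.onEdge ≫ h.onEdge = pullback.lift
          (pullback.fst A.tgt A.src ≫ m.onEdge ≫ h.onEdge)
          (pullback.snd A.tgt A.src ≫ m.onEdge ≫ h.onEdge)
          (by have := hc =≫ h.onVert
              simpa only [Category.assoc, h.tgt_comm, h.src_comm] using this) ≫ X.mul := by
      rw [h.cmp_comp]
      simp only [Category.assoc]
      rfl
    constructor
    · rintro ⟨hi, hm⟩
      rw [Category.assoc] at hi hm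
      refine ⟨⟨⟨m.onVert ≫ h.onVert, m.onEdge ≫ h.onEdge, ?_, ?_⟩, ?_, e₂.1 hm⟩, rfl, rfl⟩
      · rw [Category.assoc, h.src_comm, reassoc_of% m.src_comm]
      · rw [Category.assoc, h.tgt_comm, reassoc_of% m.tgt_comm]
      · rw [hi, Category.assoc, h.ident_comm, Category.assoc]
    · rintro ⟨F, h₀, h₁⟩
      refine ⟨?_, ?_⟩
      · rw [Category.assoc, Category.assoc, ← h₁, F.ident_comm, h₀, Category.assoc, h.ident_comm]
      · rw [Category.assoc, e₂]
        simp only [← h₁]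
        exact F.mul_comm

/-- The internal category generated by a finite family of internal categories `A i` and a finite
family of objects of arrows `R m`, with prescribed sources and targets in the `A i`. -/
theorem exists_generated [HasFiniteCoproducts E] (hU : (forgetToGraph E).IsRightAdjoint)
    {I M : Type*} [Finite I] [Finite M] (A : I → InternalCategory E) (R : M → E) (s t : M → I)
    (σ : ∀ m, R m ⟶ (A (s m)).vert) (τ : ∀ m, R m ⟶ (A (t m)).vert) :
    ∃ (C : InternalCategory E) (inc : ∀ i, Fun (A i) C) (e : ∀ m, R m ⟶ C.edge),
      (∀ m, e m ≫ C.src = σ m ≫ (inc (s m)).onVert) ∧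
      (∀ m, e m ≫ C.tgt = τ m ≫ (inc (t m)).onVert) ∧
      ∀ {X : InternalCategory E} (f : ∀ i, Fun (A i) X) (a : ∀ m, R m ⟶ X.edge),
        (∀ m, a m ≫ X.src = σ m ≫ (f (s m)).onVert) →
        (∀ m, a m ≫ X.tgt = τ m ≫ (f (t m)).onVert) →
        ∃! h : Fun C X, (∀ i, (inc i).comp h = f i) ∧ ∀ m, e m ≫ h.onEdge = a m := by
  -- Take the free category on the disjoint union of the underlying graphs of the `A i` with the new
  -- arrows adjoined; what remains is that the inclusions of the `A i` be functors.
  let G : InternalGraph E :=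
    { vert := ∐ fun i => (A i).vert
      edge := (∐ fun i => (A i).edge) ⨿ (∐ R)
      src := coprod.desc (Sigma.desc fun i => (A i).src ≫ Sigma.ι (fun i => (A i).vert) i)
        (Sigma.desc fun m => σ m ≫ Sigma.ι (fun i => (A i).vert) (s m))
      tgt := coprod.desc (Sigma.desc fun i => (A i).tgt ≫ Sigma.ι (fun i => (A i).vert) i)
        (Sigma.desc fun m => τ m ≫ Sigma.ι (fun i => (A i).vert) (t m)) }
  let v₀ : ∀ i, (A i).vert ⟶ G.vert := Sigma.ι (fun i => (A i).vert)
  let e₀ : ∀ i, (A i).edge ⟶ G.edge := fun i => Sigma.ι (fun i => (A i).edge) i ≫ coprod.inl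
  let r₀ : ∀ m, R m ⟶ G.edge := fun m => Sigma.ι R m ≫ coprod.inr
  have e₀s : ∀ i, e₀ i ≫ G.src = (A i).src ≫ v₀ i := fun i => by simp [e₀, G, v₀]
  have e₀t : ∀ i, e₀ i ≫ G.tgt = (A i).tgt ≫ v₀ i := fun i => by simp [e₀, G, v₀]
  have r₀s : ∀ m, r₀ m ≫ G.src = σ m ≫ v₀ (s m) := fun m => by simp [r₀, G, v₀]
  have r₀t : ∀ m, r₀ m ≫ G.tgt = τ m ≫ v₀ (t m) := fun m => by simp [r₀, G, v₀]
  have vext : ∀ {Z : E} {x y : G.vert ⟶ Z}, (∀ i, v₀ i ≫ x = v₀ i ≫ y) → x = y :=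
    fun h => Sigma.hom_ext _ _ h
  have eext : ∀ {Z : E} {x y : G.edge ⟶ Z}, (∀ i, e₀ i ≫ x = e₀ i ≫ y) →
      (∀ m, r₀ m ≫ x = r₀ m ≫ y) → x = y := fun h h' =>
    coprod.hom_ext (Sigma.hom_ext _ _ fun i => by simpa [e₀] using h i)
      (Sigma.hom_ext _ _ fun m => by simpa [r₀] using h' m)
  have vdesc : ∀ {Z : E} (x : ∀ i, (A i).vert ⟶ Z), ∃ y : G.vert ⟶ Z, ∀ i, v₀ i ≫ y = x i :=
    fun x => ⟨Sigma.desc x, fun i => by simp [v₀]⟩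
  have edesc : ∀ {Z : E} (x : ∀ i, (A i).edge ⟶ Z) (x' : ∀ m, R m ⟶ Z),
      ∃ y : G.edge ⟶ Z, (∀ i, e₀ i ≫ y = x i) ∧ ∀ m, r₀ m ≫ y = x' m :=
    fun x x' => ⟨coprod.desc (Sigma.desc x) (Sigma.desc x'), fun i => by simp [e₀],
      fun m => by simp [r₀]⟩
  clear_value v₀ e₀ r₀ G
  obtain ⟨D, n, hn⟩ := exists_free hU G
  let m₀ : ∀ i, InternalGraph.Hom (A i).toInternalGraph D.toInternalGraph := fun i =>
    { onVert := v₀ i ≫ n.onVert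
      onEdge := e₀ i ≫ n.onEdge
      src_comm := by rw [Category.assoc, n.src_comm, reassoc_of% e₀s]
      tgt_comm := by rw [Category.assoc, n.tgt_comm, reassoc_of% e₀t] }
  obtain ⟨C, q, hq, hC⟩ :=
    (Imposable.forall_finite fun i => Imposable.isFunctor (m₀ i)).exists_quotient
  choose inc hinc₀ hinc₁ using (hC q).2 ⟨Fun.id C, Fun.ext' (Category.comp_id _) (Category.comp_id _)⟩
  refine ⟨C, inc, fun m => r₀ m ≫ n.onEdge ≫ q.onEdge, ?_, ?_, ?_⟩
  · intro m
    simp only [Category.assoc, q.src_comm, reassoc_of% n.src_comm, reassoc_of% r₀s, hinc₀, m₀]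
  · intro m
    simp only [Category.assoc, q.tgt_comm, reassoc_of% n.tgt_comm, reassoc_of% r₀t, hinc₀, m₀]
  · intro X f a hs ht
    obtain ⟨y₀, hy₀⟩ := vdesc fun i => (f i).onVert
    obtain ⟨y₁, hy₁, hy₁'⟩ := edesc (fun i => (f i).onEdge) a
    obtain ⟨h, ⟨hh₀, hh₁⟩, -⟩ := hn (X := X) ⟨y₀, y₁,
      eext (fun i => by rw [reassoc_of% hy₁, (f i).src_comm, reassoc_of% e₀s, hy₀])
        (fun m => by rw [reassoc_of% hy₁', hs, reassoc_of% r₀s, hy₀]),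
      eext (fun i => by rw [reassoc_of% hy₁, (f i).tgt_comm, reassoc_of% e₀t, hy₀])
        (fun m => by rw [reassoc_of% hy₁', ht, reassoc_of% r₀t, hy₀])⟩
    dsimp only at hh₀ hh₁
    obtain ⟨k, rfl⟩ := (hC h).1 fun i => ⟨f i, by simp only [m₀, Category.assoc, hh₀, hy₀],
      by simp only [m₀, Category.assoc, hh₁, hy₁]⟩
    simp only [Fun.comp_onVert, Fun.comp_onEdge] at hh₀ hh₁
    refine ⟨k, ⟨fun i => Fun.ext' ?_ ?_, fun m => ?_⟩, ?_⟩
    · simp only [Fun.comp_onVert, hinc₀, m₀, Category.assoc, hh₀, hy₀]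
    · simp only [Fun.comp_onEdge, hinc₁, m₀, Category.assoc, hh₁, hy₁]
    · simp only [Category.assoc, hh₁, hy₁']
    · rintro k' ⟨hk, hk'⟩
      refine hq _ _ ((hn (X := X) ((InternalGraph.category.comp n (q.comp k).toHom))).unique
        (y₁ := q.comp k') ⟨?_, ?_⟩ ⟨rfl, rfl⟩)
      · change n.onVert ≫ q.onVert ≫ k'.onVert = n.onVert ≫ q.onVert ≫ k.onVert
        refine vext fun i => ?_
        have := Fun.congr_onVert (hk i)
        rw [Fun.comp_onVert, hinc₀] at this
        simpa only [hh₀, hy₀, m₀, Category.assoc] using this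
      · change n.onEdge ≫ q.onEdge ≫ k'.onEdge = n.onEdge ≫ q.onEdge ≫ k.onEdge
        refine eext (fun i => ?_) (fun m => ?_)
        · have := Fun.congr_onEdge (hk i)
          rw [Fun.comp_onEdge, hinc₁] at this
          simpa only [hh₁, hy₁, m₀, Category.assoc] using this
        · have := hk' m
          simpa only [hh₁, hy₁', Category.assoc] using this

/-- Equality of the composites with two given functors is imposable. In particular, `Cat(E)₁`
has coequalisers. -/
theorem Imposable.comp_eq (hU : (forgetToGraph E).IsRightAdjoint) {Z C : InternalCategory E}
    (u v : Fun Z C) : Imposable fun (X : InternalCategory E) (h : Fun C X) =>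
      u.comp h = v.comp h := by
  intro D w
  let π := coequalizer.π (u.comp w).onVert (v.comp w).onVert
  have hπ : (u.comp w).onVert ≫ π = (v.comp w).onVert ≫ π := coequalizer.condition _ _
  let G : InternalGraph E := ⟨coequalizer (u.comp w).onVert (v.comp w).onVert, D.edge,
    D.src ≫ π, D.tgt ≫ π⟩
  obtain ⟨C₀, n, hn⟩ := exists_free hU G
  let n₁ : D.edge ⟶ C₀.edge := n.onEdge
  let n₀ : coequalizer (u.comp w).onVert (v.comp w).onVert ⟶ C₀.vert := n.onVert
  have hns : n₁ ≫ C₀.src = D.src ≫ π ≫ n₀ := n.src_comm.trans (Category.assoc _ _ _)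
  have hnt : n₁ ≫ C₀.tgt = D.tgt ≫ π ≫ n₀ := n.tgt_comm.trans (Category.assoc _ _ _)
  let m : InternalGraph.Hom D.toInternalGraph C₀.toInternalGraph := ⟨π ≫ n₀, n₁, hns, hnt⟩
  obtain ⟨Q, q, hq, hQ⟩ := ((Imposable.isFunctor m).and (Imposable.onEdge_eq
    ((u.comp w).onEdge ≫ n₁) ((v.comp w).onEdge ≫ n₁)
    (by rw [Category.assoc, hns, Category.assoc, hns, reassoc_of% (u.comp w).src_comm,
          reassoc_of% (v.comp w).src_comm, reassoc_of% hπ])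
    (by rw [Category.assoc, hnt, Category.assoc, hnt, reassoc_of% (u.comp w).tgt_comm,
          reassoc_of% (v.comp w).tgt_comm, reassoc_of% hπ]))).exists_quotient
  obtain ⟨⟨F, hF₀, hF₁⟩, huv⟩ :=
    (hQ q).2 ⟨Fun.id Q, Fun.ext' (Category.comp_id _) (Category.comp_id _)⟩
  refine ⟨Q, F, fun {X} k k' hk => hq _ _ ?_, fun {X} h => ⟨fun h' => ?_, ?_⟩⟩
  · refine (hn (X := X) ((InternalGraph.category.comp n (q.comp k).toHom))).unique
      ⟨rfl, rfl⟩ (y₂ := q.comp k') ⟨?_, ?_⟩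
    · refine coequalizer.hom_ext ?_
      have := Fun.congr_onVert hk
      rw [Fun.comp_onVert, Fun.comp_onVert, hF₀] at this
      simp only [m, Category.assoc] at this
      exact this.symm
    · have := Fun.congr_onEdge hk
      rw [Fun.comp_onEdge, Fun.comp_onEdge, hF₁] at this
      simp only [m, Category.assoc] at this
      exact this.symm
  · have h₀ : (u.comp w).onVert ≫ h.onVert = (v.comp w).onVert ≫ h.onVert := by
      simpa using Fun.congr_onVert h'
    have h₁ : (u.comp w).onEdge ≫ h.onEdge = (v.comp w).onEdge ≫ h.onEdge := by
      simpa using Fun.congr_onEdge h'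
    have hd : π ≫ coequalizer.desc h.onVert h₀ = h.onVert := coequalizer.π_desc _ _
    obtain ⟨k, ⟨hk₀, hk₁⟩, -⟩ := hn (X := X) ⟨coequalizer.desc h.onVert h₀, h.onEdge,
      by change h.onEdge ≫ X.src = (D.src ≫ π) ≫ _
         rw [Category.assoc, hd, h.src_comm],
      by change h.onEdge ≫ X.tgt = (D.tgt ≫ π) ≫ _
         rw [Category.assoc, hd, h.tgt_comm]⟩
    have hk₀' : n₀ ≫ k.onVert = coequalizer.desc h.onVert h₀ := hk₀
    have hk₁' : n₁ ≫ k.onEdge = h.onEdge := hk₁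
    obtain ⟨l, rfl⟩ := (hQ k).1 ⟨⟨h, by simp only [m, Category.assoc, hk₀', hd],
      by simp only [m, hk₁']⟩, by simp only [Category.assoc, hk₁', h₁]⟩
    refine ⟨l, Fun.ext' ?_ ?_⟩
    · rw [Fun.comp_onVert, hF₀]
      simp only [m, Category.assoc]
      rw [← Fun.comp_onVert, hk₀', hd]
    · rw [Fun.comp_onEdge, hF₁]
      simp only [m, Category.assoc]
      rw [← Fun.comp_onEdge, hk₁']
  · rintro ⟨k, rfl⟩
    refine Fun.ext' ?_ ?_
    · have hF : F.onVert = π ≫ n₀ ≫ q.onVert := hF₀.trans (Category.assoc _ _ _)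
      have e : (u.comp w).onVert ≫ F.onVert = (v.comp w).onVert ≫ F.onVert := by
        rw [hF, reassoc_of% hπ]
      simpa only [Fun.comp_onVert, Category.assoc] using e =≫ k.onVert
    · have := huv =≫ k.onEdge
      simpa [hF₁, m] using this

end InternalCategory

end

section

variable {E : Type u} [Category.{v} E] [HasPullbacks E]

namespace InternalCategory

/-! ### Tensors with finitely presented categories -/

section Ext

variable {A X : InternalCategory E} {W : Type*} [Category* W]

theorem functor_ext_app {Φ Ψ : W ⥤ (A ⟶ X)} (h₀ : ∀ a, Φ.obj a = Ψ.obj a)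
    (h₁ : ∀ {a b : W} (t : a ⟶ b), Trans.app (Φ.map t) = Trans.app (Ψ.map t)) : Φ = Ψ :=
  CategoryTheory.Functor.ext h₀ fun _ _ t => eq_conj _ _ _ _ (h₁ t)

theorem congr_map_app {Φ Ψ : W ⥤ (A ⟶ X)} (h : Φ = Ψ) {a b : W} (t : a ⟶ b) :
    Trans.app (Φ.map t) = Trans.app (Ψ.map t) := by
  subst h; rfl

theorem functor_paths_ext_app {V : Type*} [Quiver V] {Φ Ψ : Paths V ⥤ (A ⟶ X)}
    (h₀ : ∀ a, Φ.obj a = Ψ.obj a)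
    (h₁ : ∀ {a b : V} (t : a ⟶ b), Trans.app (Φ.map t.toPath) = Trans.app (Ψ.map t.toPath)) :
    Φ = Ψ :=
  Paths.ext_functor (funext h₀) fun _ _ t => eq_conj _ _ _ _ (h₁ t)

theorem comp_postcomp_postcomp {Y : InternalCategory E} {Z : InternalCategory E}
    (Φ : W ⥤ (A ⟶ X)) (h : X ⟶ Y) (k : Y ⟶ Z) :
    (Φ ⋙ postcomp A h) ⋙ postcomp A k = Φ ⋙ postcomp A (h ≫ k) :=
  functor_ext_app (fun _ => Category.assoc _ _ _) fun _ => Category.assoc _ _ _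

end Ext

variable [HasPullbackStableCoequalizers E] [HasFiniteCoproducts E]

/-- The tensor of an internal category with the free category on a finite quiver. -/
theorem exists_tensor_paths (hU : (forgetToGraph E).IsRightAdjoint) (A : InternalCategory E)
    (V : Type*) [Quiver V] [Finite V] [∀ a b : V, Finite (a ⟶ b)] :
    ∃ (T : InternalCategory E) (η : Paths V ⥤ (A ⟶ T)),
      ∀ {X : InternalCategory E} (φ : Paths V ⥤ (A ⟶ X)),
        ∃! h : T ⟶ X, η ⋙ postcomp A h = φ := by
  obtain ⟨C, inc, e, hs, ht, hC⟩ := exists_generated hU (I := V) (M := Σ a b : V, a ⟶ b)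
    (fun _ => A) (fun _ => A.vert) (fun m => m.1) (fun m => m.2.1) (fun _ => 𝟙 _) (fun _ => 𝟙 _)
  simp only [Category.id_comp] at hs ht
  have n₁ : ∀ m, (inc m.1).onEdge ≫ C.tgt = (A.tgt ≫ e m) ≫ C.src := fun m => by
    rw [Category.assoc, hs, (inc m.1).tgt_comm]
  have n₂ : ∀ m, (A.src ≫ e m) ≫ C.tgt = (inc m.2.1).onEdge ≫ C.src := fun m => by
    rw [Category.assoc, ht, (inc m.2.1).src_comm]
  obtain ⟨T, q, hq, hT⟩ := (Imposable.forall_finite fun m => Imposable.onEdge_eq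
    (C.cmp _ _ (n₁ m)) (C.cmp _ _ (n₂ m)) 
    (by rw [cmp_src, cmp_src, (inc m.1).src_comm, Category.assoc, hs])
    (by rw [cmp_tgt, cmp_tgt, (inc m.2.1).tgt_comm, Category.assoc, ht])).exists_quotient
  have hqn := (hT q).2 ⟨Fun.id T, Fun.ext' (Category.comp_id _) (Category.comp_id _)⟩
  let α : V ⥤q (A ⟶ T) :=
    { obj := fun a => (inc a).comp q
      map := fun {a b} f =>
        { app := e ⟨a, b, f⟩ ≫ q.onEdge
          app_src := by rw [Category.assoc, q.src_comm, reassoc_of% hs ⟨a, b, f⟩]; rfl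
          app_tgt := by rw [Category.assoc, q.tgt_comm, reassoc_of% ht ⟨a, b, f⟩]; rfl
          naturality := by
            have := hqn ⟨a, b, f⟩
            rw [q.cmp_comp, q.cmp_comp] at this
            exact (T.cmp_congr rfl (Category.assoc _ _ _).symm _).trans
              (this.trans (T.cmp_congr (Category.assoc _ _ _) rfl _)) } }
  have hα : ∀ {a b : V} (f : a ⟶ b), Trans.app ((Paths.lift α).map f.toPath) =
      e ⟨a, b, f⟩ ≫ q.onEdge := fun f => by rw [Paths.lift_toPath]
  refine ⟨T, Paths.lift α, fun {X} φ => ?_⟩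
  obtain ⟨h, ⟨hh, hh'⟩, huniq⟩ := hC (X := X) (fun a => φ.obj a)
    (fun m => Trans.app (φ.map m.2.2.toPath))
    (fun m => (Trans.app_src _).trans (Category.id_comp _).symm)
    (fun m => (Trans.app_tgt _).trans (Category.id_comp _).symm)
  obtain ⟨k, rfl⟩ := (hT h).1 fun m => by
    rw [h.cmp_comp, h.cmp_comp]
    refine Eq.trans (X.cmp_congr ?_ ?_ _)
      ((Trans.naturality (φ.map m.2.2.toPath)).trans (X.cmp_congr ?_ ?_ _))
    · exact Fun.congr_onEdge (hh m.1)
    · rw [Category.assoc, hh']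
    · rw [Category.assoc, hh']
    · exact (Fun.congr_onEdge (hh m.2.1)).symm
  refine ⟨k, functor_paths_ext_app (fun a => (Fun.comp_assoc _ _ _).trans (hh a)) ?_, ?_⟩
  · intro a b t
    change Trans.app ((Paths.lift α).map t.toPath) ≫ k.onEdge = _
    rw [hα, Category.assoc]
    exact hh' ⟨a, b, t⟩
  · intro k' hk'
    refine hq _ _ ((huniq (q.comp k') ⟨fun a => ?_, fun m => ?_⟩))
    · exact (Fun.comp_assoc _ _ _).symm.trans (Functor.congr_obj hk' a)
    · have := congr_map_app hk' m.2.2.toPath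
      change Trans.app ((Paths.lift α).map m.2.2.toPath) ≫ (Fun.toHom k').onEdge = _ at this
      rw [hα, Category.assoc] at this
      exact this

/-- The tensor of an internal category `A` with a finitely presented category `W`: functors
`W ⥤ Cat(E)(A, X)` are represented by an internal category. -/
theorem exists_tensor (hU : (forgetToGraph E).IsRightAdjoint) (A : InternalCategory E)
    (W : Type uW) [Category.{vW} W] (hW : IsFinitelyPresentedCategory W) :
    ∃ (T : InternalCategory E) (η : W ⥤ (A ⟶ T)),
      ∀ {X : InternalCategory E} (φ : W ⥤ (A ⟶ X)), ∃! h : T ⟶ X, η ⋙ postcomp A h = φ := by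
  obtain ⟨V, _, r, P, _, _, hr, _⟩ := hW
  obtain ⟨T₀, η₀, hη₀⟩ := exists_tensor_paths hU A V
  have : Finite (Paths V) := ‹Finite V›
  have : ∀ a b : Paths V, Finite {p : (a ⟶ b) × (a ⟶ b) | r p.1 p.2} := hr
  obtain ⟨T, q, hq, hT⟩ := (Imposable.forall_finite (C := T₀)
    (ι := Σ a b : Paths V, {p : (a ⟶ b) × (a ⟶ b) | r p.1 p.2})
    fun p => Imposable.onEdge_eq (Trans.app (η₀.map p.2.2.1.1)) (Trans.app (η₀.map p.2.2.1.2))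
      (by rw [Trans.app_src, Trans.app_src]) (by rw [Trans.app_tgt, Trans.app_tgt])).exists_quotient
  have hqr := (hT q).2 ⟨Fun.id T, Fun.ext' (Category.comp_id _) (Category.comp_id _)⟩
  let q' : T₀ ⟶ T := q
  let η₁ : CategoryTheory.Quotient r ⥤ (A ⟶ T) := CategoryTheory.Quotient.lift r (η₀ ⋙ postcomp A q')
    fun a b f g hfg => hom₂_ext (hqr ⟨a, b, ⟨(f, g), hfg⟩⟩)
  have hη₁ : CategoryTheory.Quotient.functor r ⋙ η₁ = η₀ ⋙ postcomp A q' := CategoryTheory.Quotient.lift_spec _ _ _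
  have hP : P ⋙ P.strictInv = 𝟭 _ := P.asIsomorphism.unit_eq.symm
  have hP' : P.strictInv ⋙ P = 𝟭 _ := P.asIsomorphism.counit_eq
  refine ⟨T, P.strictInv ⋙ η₁, fun {X} φ => ?_⟩
  have key : ∀ k : T ⟶ X, (P.strictInv ⋙ η₁) ⋙ postcomp A k = φ ↔
      η₀ ⋙ postcomp A (q' ≫ k) = CategoryTheory.Quotient.functor r ⋙ P ⋙ φ := by
    intro k
    rw [← comp_postcomp_postcomp, ← hη₁]
    constructor
    · rintro rfl
      rw [Functor.assoc P.strictInv, ← Functor.assoc P, hP, Functor.id_comp, Functor.assoc]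
    · intro h
      rw [Functor.assoc] at h
      rw [Functor.assoc, CategoryTheory.Quotient.lift_unique' r _ _ h, ← Functor.assoc, hP', Functor.id_comp]
  obtain ⟨h, hh, huniq⟩ := hη₀ (CategoryTheory.Quotient.functor r ⋙ P ⋙ φ)
  obtain ⟨k, hk⟩ := (hT h).1 fun p => by
    have e₁ := congr_map_app hh p.2.2.1.1
    have e₂ := congr_map_app hh p.2.2.1.2
    change Trans.app (η₀.map p.2.2.1.1) ≫ (Fun.toHom h).onEdge = _ at e₁
    change Trans.app (η₀.map p.2.2.1.2) ≫ (Fun.toHom h).onEdge = _ at e₂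
    refine e₁.trans (Eq.trans ?_ e₂.symm)
    exact congrArg (fun t => Trans.app (φ.map (P.map t))) (CategoryTheory.Quotient.sound r p.2.2.2)
  refine ⟨k, (key k).2 ?_, fun k' hk' => hq _ _ ?_⟩
  · exact (congrArg (fun l : T₀ ⟶ X => η₀ ⋙ postcomp A l) hk).trans hh
  · exact (huniq _ ((key k').1 hk')).trans hk.symm

/-- Equality of two functors into a hom-category of `Cat(E)`, after composition with a functor
out of `C`, is imposable if their domain is finitely presented. -/
theorem Imposable.functor_eq
    (hU : (forgetToGraph E).IsRightAdjoint) {A C : InternalCategory E} {W : Type uW}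
    [Category.{vW} W] (hW : IsFinitelyPresentedCategory W) (Φ Ψ : W ⥤ (A ⟶ C)) :
    Imposable fun (X : InternalCategory E) (h : C ⟶ X) =>
      Φ ⋙ postcomp A h = Ψ ⋙ postcomp A h := by
  obtain ⟨T, η, hη⟩ := exists_tensor hU A W hW
  obtain ⟨a, rfl, -⟩ := hη Φ
  obtain ⟨b, rfl, -⟩ := hη Ψ
  refine (Imposable.comp_eq hU a b).congr fun X (h : C ⟶ X) => ?_
  rw [comp_postcomp_postcomp, comp_postcomp_postcomp]
  constructor
  · intro hab
    exact congrArg (fun l : T ⟶ X => η ⋙ postcomp A l) hab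
  · exact fun hab => (hη _).unique hab rfl

end InternalCategory

end

section

attribute [local simp] pullback.lift_fst pullback.lift_snd pullback.lift_fst_assoc
  pullback.lift_snd_assoc

variable {E : Type u} [Category.{v} E] [HasPullbacks E]

namespace InternalCategory

/-! ### The internal category of arrows -/

/-- The object of commutative squares `a · y = x · b` of an internal category. -/
theorem exists_squares (X : InternalCategory E) :
    ∃ (S : E) (x b a y : S ⟶ X.edge) (hxb : x ≫ X.tgt = b ≫ X.src) (hay : a ≫ X.tgt = y ≫ X.src),
      X.cmp x b hxb = X.cmp a y hay ∧
      (∀ {T : E} (x' b' a' y' : T ⟶ X.edge) (h : x' ≫ X.tgt = b' ≫ X.src)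
        (h' : a' ≫ X.tgt = y' ≫ X.src), X.cmp x' b' h = X.cmp a' y' h' →
        ∃ k : T ⟶ S, k ≫ x = x' ∧ k ≫ b = b' ∧ k ≫ a = a' ∧ k ≫ y = y') ∧
      ∀ {T : E} (k k' : T ⟶ S), k ≫ x = k' ≫ x → k ≫ b = k' ≫ b → k ≫ a = k' ≫ a →
        k ≫ y = k' ≫ y → k = k' := by
  refine ⟨pullback X.mul X.mul, pullback.fst _ _ ≫ pullback.fst _ _,
    pullback.fst _ _ ≫ pullback.snd _ _, pullback.snd _ _ ≫ pullback.fst _ _,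
    pullback.snd _ _ ≫ pullback.snd _ _, by simp [pullback.condition],
    by simp [pullback.condition], ?_, ?_, ?_⟩
  · rw [← comp_cmp _ _ _ _ pullback.condition, ← comp_cmp _ _ _ _ pullback.condition, cmp_fst_snd,
      pullback.condition]
  · intro T x' b' a' y' h h' e
    have e' : pullback.lift x' b' h ≫ X.mul = pullback.lift a' y' h' ≫ X.mul := e
    exact ⟨pullback.lift (pullback.lift x' b' h) (pullback.lift a' y' h') e', by simp, by simp,
      by simp, by simp⟩
  · intro T k k' h₁ h₂ h₃ h₄
    apply pullback.hom_ext <;> apply pullback.hom_ext <;> simpa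

/-- A transformation `κ : d ⇒ c` between functors `P ⟶ X` exhibits `P` as the power of `X` by the
arrow category: functors `A ⟶ P` are the internal natural transformations between functors
`A ⟶ X`, and the transformations between them are the commutative squares of transformations. -/
structure IsArrowPower {P X : InternalCategory E} {d c : Fun P X} (κ : Trans d c) : Prop where
  exists_lift {A : InternalCategory E} {f g : Fun A X} (α : Trans f g) :
    ∃ H : Fun A P, H.comp d = f ∧ H.comp c = g ∧ H.onVert ≫ κ.app = α.app
  fun_ext {A : InternalCategory E} {H H' : Fun A P} (hd : H.comp d = H'.comp d)
    (hc : H.comp c = H'.comp c) (h : H.onVert ≫ κ.app = H'.onVert ≫ κ.app) : H = H'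
  exists_trans {A : InternalCategory E} {H H' : Fun A P} (β : Trans (H.comp d) (H'.comp d))
    (γ : Trans (H.comp c) (H'.comp c)) (h : (H.onVert ≫ κ.app) ≫ X.tgt = γ.app ≫ X.src)
    (h' : β.app ≫ X.tgt = (H'.onVert ≫ κ.app) ≫ X.src)
    (e : X.cmp (H.onVert ≫ κ.app) γ.app h = X.cmp β.app (H'.onVert ≫ κ.app) h') :
    ∃ Γ : Trans H H', Γ.app ≫ d.onEdge = β.app ∧ Γ.app ≫ c.onEdge = γ.app
  trans_ext {A : InternalCategory E} {H H' : Fun A P} {Γ Γ' : Trans H H'}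
    (hd : Γ.app ≫ d.onEdge = Γ'.app ≫ d.onEdge) (hc : Γ.app ≫ c.onEdge = Γ'.app ≫ c.onEdge) :
    Γ = Γ'

/-- The power of `X` by the arrow category has the arrows of `X` as objects and the commutative
squares of `X` as arrows. -/
theorem exists_isArrowPower (X : InternalCategory E) :
    ∃ (P : InternalCategory E) (d c : Fun P X) (κ : Trans d c), IsArrowPower κ := by
  obtain ⟨S, x, b, a, y, hxb, hay, comm, lift, ext⟩ := X.exists_squares
  -- Vertical pasting of squares: `a · a'` and `b · b'` are composed along `y = x'`.
  have pasting : ∀ {T : E} (k l : T ⟶ S) (hkl : k ≫ y = l ≫ x)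
      (hb : (k ≫ b) ≫ X.tgt = (l ≫ b) ≫ X.src) (ha : (k ≫ a) ≫ X.tgt = (l ≫ a) ≫ X.src),
      ∃ n : T ⟶ S, n ≫ x = k ≫ x ∧ n ≫ b = X.cmp (k ≫ b) (l ≫ b) hb ∧
        n ≫ a = X.cmp (k ≫ a) (l ≫ a) ha ∧ n ≫ y = l ≫ y := by
    intro T k l hkl hb ha
    have hkx : (k ≫ x) ≫ X.tgt = (k ≫ b) ≫ X.src := by simp [hxb]
    have hky : (k ≫ a) ≫ X.tgt = (k ≫ y) ≫ X.src := by simp [hay]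
    have hlx : (l ≫ x) ≫ X.tgt = (l ≫ b) ≫ X.src := by simp [hxb]
    have hly : (l ≫ a) ≫ X.tgt = (l ≫ y) ≫ X.src := by simp [hay]
    have hkyb : (k ≫ y) ≫ X.tgt = (l ≫ b) ≫ X.src := by rw [hkl, hlx]
    have ck : X.cmp (k ≫ x) (k ≫ b) hkx = X.cmp (k ≫ a) (k ≫ y) hky := by
      rw [← comp_cmp _ _ _ _ hxb, comm, comp_cmp]
    have cl : X.cmp (l ≫ x) (l ≫ b) hlx = X.cmp (l ≫ a) (l ≫ y) hly := by
      rw [← comp_cmp _ _ _ _ hxb, comm, comp_cmp]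
    refine lift (k ≫ x) _ _ (l ≫ y) (by rw [cmp_src, hkx]) (by rw [cmp_tgt, hly]) ?_
    rw [← X.cmp_assoc _ _ _ hkx hb, X.cmp_congr ck rfl, X.cmp_assoc _ _ _ hky hkyb,
      X.cmp_congr rfl (X.cmp_congr hkl rfl _), X.cmp_congr rfl cl, X.cmp_assoc]
  have hb : ∀ {T : E} (k l : T ⟶ S), k ≫ y = l ≫ x → (k ≫ b) ≫ X.tgt = (l ≫ b) ≫ X.src := by
    intro T k l hkl
    have := congrArg (k ≫ · ≫ X.tgt) comm
    simp only [cmp_tgt] at this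
    rw [Category.assoc, this, reassoc_of% hkl, hxb, Category.assoc]
  have ha : ∀ {T : E} (k l : T ⟶ S), k ≫ y = l ≫ x → (k ≫ a) ≫ X.tgt = (l ≫ a) ≫ X.src := by
    intro T k l hkl
    have := congrArg (l ≫ · ≫ X.src) comm
    simp only [cmp_src] at this
    rw [Category.assoc, hay, reassoc_of% hkl, this, Category.assoc]
  obtain ⟨i, hix, hib, hia, hiy⟩ := lift (𝟙 X.edge) (X.tgt ≫ X.ident) (X.src ≫ X.ident) (𝟙 _)
    (by simp [X.ident_src]) (by simp [X.ident_tgt])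
    (by rw [X.cmp_ident _ _ (Category.id_comp _).symm, X.ident_cmp _ _ (Category.id_comp _).symm])
  obtain ⟨m, hmx, hmb, hma, hmy⟩ := pasting (pullback.fst y x) (pullback.snd y x)
    pullback.condition (hb _ _ pullback.condition) (ha _ _ pullback.condition)
  have hm : ∀ {T : E} (k l : T ⟶ S) (h : k ≫ y = l ≫ x),
      (pullback.lift k l h ≫ m) ≫ x = k ≫ x ∧
      (pullback.lift k l h ≫ m) ≫ b = X.cmp (k ≫ b) (l ≫ b) (hb k l h) ∧
      (pullback.lift k l h ≫ m) ≫ a = X.cmp (k ≫ a) (l ≫ a) (ha k l h) ∧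
      (pullback.lift k l h ≫ m) ≫ y = l ≫ y := by
    intro T k l h
    refine ⟨by simp [hmx], ?_, ?_, by simp [hmy]⟩
    · rw [Category.assoc, hmb, comp_cmp]
      exact X.cmp_congr (by simp) (by simp) _
    · rw [Category.assoc, hma, comp_cmp]
      exact X.cmp_congr (by simp) (by simp) _
  have idm : ∀ {T : E} (k : T ⟶ S) (h : (k ≫ x ≫ i) ≫ y = k ≫ x),
      pullback.lift (k ≫ x ≫ i) k h ≫ m = k := by
    intro T k h
    obtain ⟨h₁, h₂, h₃, h₄⟩ := hm _ _ h
    refine ext _ _ ?_ ?_ ?_ h₄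
    · rw [h₁]; simp [hix]
    · rw [h₂, X.cmp_congr (g' := k ≫ b) (f' := (k ≫ x ≫ X.tgt) ≫ X.ident) (by simp [hib]) rfl,
        X.ident_cmp _ _ (by simp [hxb])]
    · rw [h₃, X.cmp_congr (g' := k ≫ a) (f' := (k ≫ x ≫ X.src) ≫ X.ident) (by simp [hia]) rfl,
        X.ident_cmp]
      have := congrArg (k ≫ · ≫ X.src) comm
      simpa only [cmp_src, Category.assoc] using this
  have mid : ∀ {T : E} (k : T ⟶ S) (h : k ≫ y = (k ≫ y ≫ i) ≫ x),
      pullback.lift k (k ≫ y ≫ i) h ≫ m = k := by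
    intro T k h
    obtain ⟨h₁, h₂, h₃, h₄⟩ := hm _ _ h
    refine ext _ _ h₁ ?_ ?_ ?_
    · rw [h₂, X.cmp_congr (f' := k ≫ b) (g' := (k ≫ y ≫ X.tgt) ≫ X.ident) rfl (by simp [hib]),
        X.cmp_ident]
      have := congrArg (k ≫ · ≫ X.tgt) comm
      simpa only [cmp_tgt, Category.assoc] using this.symm
    · rw [h₃, X.cmp_congr (f' := k ≫ a) (g' := (k ≫ y ≫ X.src) ≫ X.ident) rfl (by simp [hia]),
        X.cmp_ident _ _ (by simp [hay])]
    · rw [h₄]; simp [hiy]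
  let P : InternalCategory E := ofElements ⟨X.edge, S, x, y⟩ i m hix hiy hmx hmy idm mid (by
    intro T k l n hkl hln h₁ h₂
    obtain ⟨p₁, p₂, p₃, p₄⟩ := hm k l hkl
    obtain ⟨q₁, q₂, q₃, q₄⟩ := hm l n hln
    obtain ⟨r₁, r₂, r₃, r₄⟩ := hm _ _ h₁
    obtain ⟨s₁, s₂, s₃, s₄⟩ := hm _ _ h₂
    refine ext _ _ (by rw [r₁, s₁, p₁]) ?_ ?_ (by rw [r₄, s₄, q₄])
    · rw [r₂, s₂, X.cmp_congr p₂ rfl, X.cmp_congr rfl q₂, X.cmp_assoc _ _ _ _ (hb l n hln)]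
    · rw [r₃, s₃, X.cmp_congr p₃ rfl, X.cmp_congr rfl q₃, X.cmp_assoc _ _ _ _ (ha l n hln)])
  have hsx : x ≫ X.src = a ≫ X.src := by
    simpa only [cmp_src] using congrArg (· ≫ X.src) comm
  have hty : y ≫ X.tgt = b ≫ X.tgt := by
    simpa only [cmp_tgt] using (congrArg (· ≫ X.tgt) comm).symm
  let d : Fun P X := funOfElements ⟨X.src, a, hsx.symm, hay⟩ hia
    (fun k l h h' => (hm k l h).2.2.1)
  let c : Fun P X := funOfElements ⟨X.tgt, b, hxb.symm, hty.symm⟩ hib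
    (fun k l h h' => (hm k l h).2.1)
  let κ : Trans d c :=
    { app := 𝟙 X.edge
      app_src := Category.id_comp _
      app_tgt := Category.id_comp _
      naturality := by
        refine Eq.trans (X.cmp_congr (f' := a) (g' := y) rfl (Category.comp_id y) _)
          (Eq.trans comm.symm (X.cmp_congr (Category.comp_id x).symm rfl _)) }
  refine ⟨P, d, c, κ, ⟨?_, ?_, ?_, ?_⟩⟩
  · intro A f g α
    obtain ⟨k, hkx, hkb, hka, hky⟩ := lift _ _ _ _ _ _ α.naturality.symm
    have hi : A.ident ≫ k = α.app ≫ i := by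
      refine ext _ _ ?_ ?_ ?_ ?_
      · simp [hkx, hix, reassoc_of% A.ident_src]
      · simp [hkb, hib, g.ident_comm, ← α.app_tgt]
      · simp [hka, hia, f.ident_comm, ← α.app_src]
      · simp [hky, hiy, reassoc_of% A.ident_tgt]
    have hmul : ∀ {T : E} (u v : T ⟶ A.edge) (h : u ≫ A.tgt = v ≫ A.src)
        (h' : (u ≫ k) ≫ y = (v ≫ k) ≫ x),
        A.cmp u v h ≫ k = pullback.lift (u ≫ k) (v ≫ k) h' ≫ m := by
      intro T u v h h'
      obtain ⟨h₁, h₂, h₃, h₄⟩ := hm _ _ h'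
      refine ext _ _ ?_ ?_ ?_ ?_
      · rw [h₁, Category.assoc, Category.assoc, hkx, ← Category.assoc, cmp_src, Category.assoc]
      · rw [h₂, Category.assoc, hkb, g.cmp_comp]
        exact X.cmp_congr (by simp [hkb]) (by simp [hkb]) _
      · rw [h₃, Category.assoc, hka, f.cmp_comp]
        exact X.cmp_congr (by simp [hka]) (by simp [hka]) _
      · rw [h₄, Category.assoc, Category.assoc, hky, ← Category.assoc, cmp_tgt, Category.assoc]
    exact ⟨funOfElements ⟨α.app, k, hkx, hky⟩ hi hmul,
      Fun.ext' α.app_src hka, Fun.ext' α.app_tgt hkb, Category.comp_id _⟩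
  · intro A H H' hd hc h
    have h₀ : H.onVert = H'.onVert :=
      (Category.comp_id _).symm.trans (h.trans (Category.comp_id _))
    refine Fun.ext' h₀ (ext _ _ ?_ (Fun.congr_onEdge hc) (Fun.congr_onEdge hd) ?_)
    · exact H.src_comm.trans ((congrArg (A.src ≫ ·) h₀).trans H'.src_comm.symm)
    · exact H.tgt_comm.trans ((congrArg (A.tgt ≫ ·) h₀).trans H'.tgt_comm.symm)
  · intro A H H' β γ h h' e
    have hH : H.onVert ≫ κ.app = H.onVert := Category.comp_id _
    have hH' : H'.onVert ≫ κ.app = H'.onVert := Category.comp_id _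
    obtain ⟨k, hkx, hkb, hka, hky⟩ := lift _ _ _ _ h h' e
    rw [hH] at hkx
    rw [hH'] at hky
    have nat : ∀ (h₁ : H.onEdge ≫ y = (A.tgt ≫ k) ≫ x) (h₂ : (A.src ≫ k) ≫ y = H'.onEdge ≫ x),
        pullback.lift H.onEdge (A.tgt ≫ k) h₁ ≫ m =
          pullback.lift (A.src ≫ k) H'.onEdge h₂ ≫ m := by
      intro h₁ h₂
      obtain ⟨p₁, p₂, p₃, p₄⟩ := hm _ _ h₁
      obtain ⟨q₁, q₂, q₃, q₄⟩ := hm _ _ h₂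
      refine ext _ _ ?_ ?_ ?_ ?_
      · exact p₁.trans ((H.src_comm.trans (by rw [Category.assoc, hkx]; rfl)).trans q₁.symm)
      · exact p₂.trans (Eq.trans ((X.cmp_congr rfl (by rw [Category.assoc, hkb]) _).trans
          (γ.naturality.trans (X.cmp_congr (by rw [Category.assoc, hkb]) rfl _))) q₂.symm)
      · exact p₃.trans (Eq.trans ((X.cmp_congr rfl (by rw [Category.assoc, hka]) _).trans
          (β.naturality.trans (X.cmp_congr (by rw [Category.assoc, hka]) rfl _))) q₃.symm)
      · exact p₄.trans (Eq.trans (Eq.trans (by rw [Category.assoc, hky]; rfl) H'.tgt_comm.symm)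
          q₄.symm)
    exact ⟨⟨k, hkx, hky, nat _ _⟩, hka, hkb⟩
  · intro A H H' Γ Γ' hd hc
    exact Trans.ext (ext _ _ (Γ.app_src.trans Γ'.app_src.symm) hc hd
      (Γ.app_tgt.trans Γ'.app_tgt.symm))

end InternalCategory

end

section

variable {E : Type u} [Category.{v} E] [HasPullbacks E]

namespace InternalCategory

section Power

variable {P X : InternalCategory E} {d c : P ⟶ X} {κ : d ⟶ c} {W : Type*} [Category* W]
  {A : InternalCategory E}

theorem IsArrowPower.functor_ext (hκ : IsArrowPower κ) {ρ ρ' : W ⥤ (A ⟶ P)}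
    (hd : ρ ⋙ postcomp A d = ρ' ⋙ postcomp A d) (hc : ρ ⋙ postcomp A c = ρ' ⋙ postcomp A c)
    (h : ∀ a, (Fun.toHom (ρ.obj a)).onVert ≫ Trans.app κ =
      (Fun.toHom (ρ'.obj a)).onVert ≫ Trans.app κ) : ρ = ρ' := by
  have h₀ : ∀ a, ρ.obj a = ρ'.obj a := fun a =>
    hκ.fun_ext (Functor.congr_obj hd a) (Functor.congr_obj hc a) (h a)
  refine CategoryTheory.Functor.ext h₀ fun a b t => ?_
  refine hκ.trans_ext ?_ ?_
  · refine (congr_map_app hd t).trans ?_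
    rw [eqToHom_comp_app (h₀ a), comp_eqToHom_app]
    rfl
  · refine (congr_map_app hc t).trans ?_
    rw [eqToHom_comp_app (h₀ a), comp_eqToHom_app]
    rfl

/-- A natural transformation between functors into `Cat(E)(A, X)` is a functor into
`Cat(E)(A, P)`, for `P` the power of `X` by the arrow category. -/
theorem IsArrowPower.exists_functor (hκ : IsArrowPower κ) {Φ Ψ : W ⥤ (A ⟶ X)} (μ : Φ ⟶ Ψ) :
    ∃ ρ : W ⥤ (A ⟶ P), ρ ⋙ postcomp A d = Φ ∧ ρ ⋙ postcomp A c = Ψ ∧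
      ∀ a, (Fun.toHom (ρ.obj a)).onVert ≫ Trans.app κ = Trans.app (μ.app a) := by
  choose H hd hc hH using fun a => hκ.exists_lift (μ.app a)
  let H' : W → (A ⟶ P) := H
  have hd' : ∀ a, H' a ≫ d = Φ.obj a := hd
  have hc' : ∀ a, H' a ≫ c = Ψ.obj a := hc
  have sq : ∀ {a b : W} (t : a ⟶ b), ∃ Γ : H' a ⟶ H' b,
      Trans.app Γ ≫ (Fun.toHom d).onEdge = Trans.app (Φ.map t) ∧
      Trans.app Γ ≫ (Fun.toHom c).onEdge = Trans.app (Ψ.map t) := by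
    intro a b t
    let β : H' a ≫ d ⟶ H' b ≫ d := eqToHom (hd' a) ≫ Φ.map t ≫ eqToHom (hd' b).symm
    let γ : H' a ≫ c ⟶ H' b ≫ c := eqToHom (hc' a) ≫ Ψ.map t ≫ eqToHom (hc' b).symm
    have hβ : Trans.app β = Trans.app (Φ.map t) := by
      rw [eqToHom_comp_app, comp_eqToHom_app]
    have hγ : Trans.app γ = Trans.app (Ψ.map t) := by
      rw [eqToHom_comp_app, comp_eqToHom_app]
    have nat := congrArg Trans.app (μ.naturality t)
    have e₁ : (H a).onVert ≫ Trans.app κ = Trans.app (μ.app a) := hH a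
    have e₂ : (H b).onVert ≫ Trans.app κ = Trans.app (μ.app b) := hH b
    obtain ⟨Γ, h₁, h₂⟩ := hκ.exists_trans β γ
      (by rw [e₁, hγ, Trans.app_tgt, Trans.app_src])
      (by rw [e₂, hβ, Trans.app_tgt, Trans.app_src])
      ((X.cmp_congr e₁ hγ _).trans (nat.symm.trans (X.cmp_congr hβ e₂ _).symm))
    exact ⟨Γ, h₁.trans hβ, h₂.trans hγ⟩
  choose Γ h₁ h₂ using @sq
  have map_id : ∀ a, Γ (𝟙 a) = 𝟙 (H' a) := by
    intro a
    refine hκ.trans_ext ?_ ?_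
    · refine (h₁ (𝟙 a)).trans ?_
      change _ = Trans.app ((postcomp A d).map (𝟙 (H' a)))
      rw [Φ.map_id, CategoryTheory.Functor.map_id]
      exact congrArg (fun f : A ⟶ X => Trans.app (𝟙 f)) (hd' a).symm
    · refine (h₂ (𝟙 a)).trans ?_
      change _ = Trans.app ((postcomp A c).map (𝟙 (H' a)))
      rw [Ψ.map_id, CategoryTheory.Functor.map_id]
      exact congrArg (fun f : A ⟶ X => Trans.app (𝟙 f)) (hc' a).symm
  have map_comp : ∀ {a b e : W} (s : a ⟶ b) (t : b ⟶ e), Γ (s ≫ t) = Γ s ≫ Γ t := by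
    intro a b e s t
    refine hκ.trans_ext ?_ ?_
    · refine (h₁ (s ≫ t)).trans ?_
      change _ = Trans.app ((postcomp A d).map (Γ s ≫ Γ t))
      rw [Φ.map_comp, Functor.map_comp]
      exact X.cmp_congr (h₁ s).symm (h₁ t).symm _
    · refine (h₂ (s ≫ t)).trans ?_
      change _ = Trans.app ((postcomp A c).map (Γ s ≫ Γ t))
      rw [Ψ.map_comp, Functor.map_comp]
      exact X.cmp_congr (h₂ s).symm (h₂ t).symm _
  exact ⟨{ obj := H', map := Γ, map_id := map_id, map_comp := map_comp },
    functor_ext_app hd' h₁, functor_ext_app hc' h₂, hH⟩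

end Power

end InternalCategory

/-! ### Weighted cocones as families of functors -/

theorem IsFinitelyPresentedCategory.finite {C : Type u} [Category.{v} C]
    (hC : IsFinitelyPresentedCategory C) : Finite C := by
  obtain ⟨V, _, r, P, _, _, _, _⟩ := hC
  have : Finite (Paths V) := ‹Finite V›
  exact Finite.of_equiv _ ((CategoryTheory.Quotient.equiv r).symm.trans P.objEquiv)

namespace WeightedCocone

open InternalCategory

variable {J : Type uJ} [Bicategory.{wJ, vJ} J] (W : StrictPseudofunctor Jᵒᵖ Cat.{vW, uW})
  (F : StrictPseudofunctor J (InternalCategory E))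

/-- The functor `J(j, k) ⥤ W(j)` given by the action of the weight on `x : W(k)`. -/
def weightEval (j : J) {k : J} (x : W.obj (op k)) : (j ⟶ k) ⥤ W.obj (op j) where
  obj f := (W.map f.op).toFunctor.obj x
  map α := (W.map₂ (Bicategory.Opposite.op2 α)).toNatTrans.app x
  map_id f := by
    rw [Bicategory.Opposite.op2_id, W.map₂_id]; rfl
  map_comp α β := by
    rw [Bicategory.Opposite.op2_comp, W.map₂_comp]; rfl

/-- The functor `J(j, k) ⥤ Cat(E)(F j, F k)` given by a diagram `F`. -/
def diagramHom (j k : J) : (j ⟶ k) ⥤ (F.obj j ⟶ F.obj k) where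
  obj f := F.map f
  map α := F.map₂ α
  map_id f := F.map₂_id f
  map_comp α β := F.map₂_comp α β

variable {W F}

/-- A family of functors `W(j) ⥤ Cat(E)(F j, X)` is 2-natural. Both clauses are equalities of
functors whose domains are categories of the given data: naturality at 1-cells is an equality of
functors on `W(k)`, naturality at 2-cells is an equality of functors on `J(j, k)`. -/
structure IsTwoNatural {X : InternalCategory E}
    (τ : ∀ j : J, W.obj (op j) ⥤ (F.obj j ⟶ X)) : Prop where
  one {j k : J} (f : j ⟶ k) :
    (W.map f.op).toFunctor ⋙ τ j = τ k ⋙ precomp X (F.map f)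
  two (j : J) {k : J} (x : W.obj (op k)) :
    weightEval W j x ⋙ τ j = diagramHom F j k ⋙ postcomp (F.obj j) ((τ k).obj x)

theorem isTwoNatural {X : InternalCategory E} (σ : WeightedCocone W F X) :
    IsTwoNatural σ.app where
  one f := CategoryTheory.Functor.ext (σ.nat_obj f) fun _ _ t => σ.nat_map f t
  two _ _ x := CategoryTheory.Functor.ext (fun f => σ.nat_obj f x) fun _ _ α => σ.nat_two α x

/-- The weighted cocone given by a 2-natural family of functors. -/
def ofIsTwoNatural {X : InternalCategory E} (τ : ∀ j : J, W.obj (op j) ⥤ (F.obj j ⟶ X))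
    (hτ : IsTwoNatural τ) : WeightedCocone W F X where
  app := τ
  nat_obj f x := Functor.congr_obj (hτ.one f) x
  nat_map f _ _ t := Functor.congr_hom (hτ.one f) t
  nat_two {j _ _ _} α x := Functor.congr_hom (hτ.two j x) α

/-- A modification between weighted cocones with vertex `X` is a weighted cocone whose vertex is the
power of `X` by the arrow category. -/
theorem exists_of_hom {P X : InternalCategory E} {d c : P ⟶ X} {κ : d ⟶ c} (hκ : IsArrowPower κ)
    {σ τ : WeightedCocone W F X} (m : σ ⟶ τ) :
    ∃ ρ : WeightedCocone W F P, ρ.extend d = σ ∧ ρ.extend c = τ ∧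
      ∀ j x, (Fun.toHom ((ρ.app j).obj x)).onVert ≫ Trans.app κ =
        Trans.app ((Hom.app m j).app x) := by
  choose ρ hd hc hρ using fun j => hκ.exists_functor (Hom.app m j)
  have hρm : ∀ {j k : J} (f : j ⟶ k) (x : W.obj (op k)),
      (Fun.toHom ((ρ j).obj ((W.map f.op).toFunctor.obj x))).onVert ≫ Trans.app κ =
        (Fun.toHom (F.map f ≫ (ρ k).obj x)).onVert ≫ Trans.app κ := by
    intro j k f x
    refine (hρ j _).trans ?_
    rw [Hom.nat m f x, eqToHom_comp_app, comp_eqToHom_app]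
    refine Eq.trans ?_ (Category.assoc _ _ _).symm
    exact congrArg ((Fun.toHom (F.map f)).onVert ≫ ·) (hρ k x).symm
  have nat : IsTwoNatural ρ :=
    { one := fun {j k} f => by
        have key : ∀ (g : P ⟶ X) (ω : WeightedCocone W F X),
            (∀ j, ρ j ⋙ postcomp (F.obj j) g = ω.app j) →
            ((W.map f.op).toFunctor ⋙ ρ j) ⋙ postcomp (F.obj j) g =
              (ρ k ⋙ precomp P (F.map f)) ⋙ postcomp (F.obj j) g := by
          intro g ω hω
          rw [Functor.assoc, hω j, ω.isTwoNatural.one f, ← hω k]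
          exact functor_ext_app (fun _ => (Category.assoc _ _ _).symm)
            fun _ => (Category.assoc _ _ _).symm
        exact hκ.functor_ext (key d σ hd) (key c τ hc) (hρm f)
      two := fun j k x => by
        have key : ∀ (g : P ⟶ X) (ω : WeightedCocone W F X),
            (∀ j, ρ j ⋙ postcomp (F.obj j) g = ω.app j) →
            (weightEval W j x ⋙ ρ j) ⋙ postcomp (F.obj j) g =
              (diagramHom F j k ⋙ postcomp (F.obj j) ((ρ k).obj x)) ⋙
                postcomp (F.obj j) g := by
          intro g ω hω
          rw [Functor.assoc, hω j, ω.isTwoNatural.two j x, ← hω k, comp_postcomp_postcomp]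
          rfl
        exact hκ.functor_ext (key d σ hd) (key c τ hc) fun f => hρm f x }
  exact ⟨ofIsTwoNatural ρ nat, WeightedCocone.ext (funext hd), WeightedCocone.ext (funext hc), hρ⟩

theorem extend_extend {X Y Z : InternalCategory E} (σ : WeightedCocone W F X) (h : X ⟶ Y)
    (k : Y ⟶ Z) : (σ.extend h).extend k = σ.extend (h ≫ k) :=
  WeightedCocone.ext (funext fun j => comp_postcomp_postcomp (σ.app j) h k)

/-- Since `Cat(E)` has powers by the arrow category, the one-dimensional universal property of a
weighted cocone implies the two-dimensional one. -/
theorem isTwoColimit_of_bijective {X : InternalCategory E} (σ : WeightedCocone W F X)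
    (hσ : ∀ Y : InternalCategory E, Function.Bijective fun h : X ⟶ Y => σ.extend h) :
    σ.IsTwoColimit := by
  intro Y
  obtain ⟨P, d, c, κ, hκ⟩ := exists_isArrowPower Y
  refine { faithful := ⟨?_⟩, full := ⟨?_⟩, bijective_obj := hσ Y }
  · intro h k θ θ' hθ
    obtain ⟨H, hd, hc, hH⟩ := hκ.exists_lift θ
    obtain ⟨H', hd', hc', hH'⟩ := hκ.exists_lift θ'
    have e : H = H' := by
      refine (hσ P).1 (WeightedCocone.ext (funext fun j => hκ.functor_ext ?_ ?_ fun x => ?_))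
      · exact (comp_postcomp_postcomp (σ.app j) H d).trans
          ((congrArg (fun l : X ⟶ Y => σ.app j ⋙ postcomp _ l) (hd.trans hd'.symm)).trans
            (comp_postcomp_postcomp (σ.app j) H' d).symm)
      · exact (comp_postcomp_postcomp (σ.app j) H c).trans
          ((congrArg (fun l : X ⟶ Y => σ.app j ⋙ postcomp _ l) (hc.trans hc'.symm)).trans
            (comp_postcomp_postcomp (σ.app j) H' c).symm)
      · have := congrArg (fun m => Trans.app ((Hom.app m j).app x)) hθ
        refine (Category.assoc _ _ _).trans (Eq.trans ?_ (Category.assoc _ _ _).symm)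
        exact ((congrArg (_ ≫ ·) hH).trans this).trans (congrArg (_ ≫ ·) hH').symm
    subst e
    exact hom₂_ext (hH.symm.trans hH')
  · intro h k m
    obtain ⟨ρ, hd, hc, hρ⟩ := exists_of_hom hκ m
    obtain ⟨H, rfl⟩ := (hσ P).2 ρ
    dsimp only at hd hc hρ
    rw [extend_extend] at hd hc
    obtain rfl := (hσ Y).1 hd
    obtain rfl := (hσ Y).1 hc
    refine ⟨wLeft H κ, Hom.ext (funext fun j => NatTrans.ext (funext fun x => hom₂_ext ?_))⟩
    exact (Category.assoc _ _ _).symm.trans (hρ j x)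

/-- Tensors with the values of the weight, a finite coproduct of them and a quotient of the result
by finitely many equations give the weighted colimit. -/
theorem exists_isTwoColimit [Bicategory.Strict J] [HasPullbackStableCoequalizers E]
    [HasFiniteCoproducts E] (hU : (forgetToGraph E).IsRightAdjoint) [Finite J]
    (hJ : ∀ j k : J, IsFinitelyPresentedCategory (j ⟶ k))
    (hW : ∀ j : J, IsFinitelyPresentedCategory (W.obj (op j))) :
    ∃ (X : InternalCategory E) (σ : WeightedCocone W F X), σ.IsTwoColimit := by
  have : ∀ j k : J, Finite (j ⟶ k) := fun j k => (hJ j k).finite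
  have : ∀ j : J, Finite (W.obj (op j)) := fun j => (hW j).finite
  choose T η hη using fun j => exists_tensor hU (F.obj j) (W.obj (op j)) (hW j)
  obtain ⟨C, inc, _, -, -, hC⟩ := exists_generated hU (M := Empty) T Empty.elim Empty.elim
    Empty.elim (fun m => m.elim) (fun m => m.elim)
  let inc' : ∀ j, T j ⟶ C := inc
  let ζ : ∀ j, W.obj (op j) ⥤ (F.obj j ⟶ C) := fun j => η j ⋙ postcomp (F.obj j) (inc' j)
  have hζ : ∀ {X : InternalCategory E} (τ : ∀ j, W.obj (op j) ⥤ (F.obj j ⟶ X)),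
      ∃! h : C ⟶ X, ∀ j, ζ j ⋙ postcomp (F.obj j) h = τ j := by
    intro X τ
    choose t ht htu using fun j => hη j (τ j)
    obtain ⟨h, ⟨hh, -⟩, hu⟩ := hC (X := X) t (fun m => m.elim) (fun m => m.elim) (fun m => m.elim)
    refine ⟨h, fun j => ?_, fun h' hh' => hu h' ⟨fun j => htu j (inc' j ≫ h') ?_, fun m => m.elim⟩⟩
    · rw [comp_postcomp_postcomp, ← ht j]
      exact congrArg (fun l : T j ⟶ X => η j ⋙ postcomp _ l) (hh j)
    · exact (comp_postcomp_postcomp _ _ _).symm.trans (hh' j)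
  -- 2-naturality of the induced family amounts to finitely many equations of functors out of `C`.
  have imp : Imposable fun (X : InternalCategory E) (h : C ⟶ X) =>
      IsTwoNatural (W := W) (F := F) fun j => ζ j ⋙ postcomp (F.obj j) h := by
    refine ((Imposable.forall_finite fun p : Σ j k : J, (j ⟶ k) =>
      Imposable.functor_eq hU (hW p.2.1) ((W.map p.2.2.op).toFunctor ⋙ ζ p.1)
        (ζ p.2.1 ⋙ precomp C (F.map p.2.2))).and
      (Imposable.forall_finite fun p : J × Σ k : J, W.obj (op k) =>
        Imposable.functor_eq hU (hJ p.1 p.2.1) (weightEval W p.1 p.2.2 ⋙ ζ p.1)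
          (diagramHom F p.1 p.2.1 ⋙ postcomp _ ((ζ p.2.1).obj p.2.2)))).congr
      fun X (h : C ⟶ X) => ?_
    have e₁ : ∀ {j k : J} (f : j ⟶ k), (ζ k ⋙ precomp C (F.map f)) ⋙ postcomp _ h =
        (ζ k ⋙ postcomp _ h) ⋙ precomp X (F.map f) := fun f =>
      functor_ext_app (fun _ => Category.assoc _ _ _) fun _ => Category.assoc _ _ _
    have e₂ : ∀ (j : J) {k : J} (x : W.obj (op k)),
        (diagramHom F j k ⋙ postcomp _ ((ζ k).obj x)) ⋙ postcomp _ h =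
          diagramHom F j k ⋙ postcomp _ ((ζ k ⋙ postcomp _ h).obj x) := fun j {k} x =>
      comp_postcomp_postcomp _ _ _
    constructor
    · rintro ⟨h₁, h₂⟩
      exact ⟨fun {j k} f => (h₁ ⟨j, k, f⟩).trans (e₁ f), fun j k x =>
        (h₂ (j, ⟨k, x⟩)).trans (e₂ j x)⟩
    · rintro ⟨h₁, h₂⟩
      exact ⟨fun p => (h₁ p.2.2).trans (e₁ p.2.2).symm, fun p =>
        (h₂ p.1 p.2.2).trans (e₂ p.1 p.2.2).symm⟩
  obtain ⟨Q, q, hq, hQ⟩ := imp.exists_quotient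
  let q' : C ⟶ Q := q
  have nat : IsTwoNatural (W := W) (F := F) fun j => ζ j ⋙ postcomp (F.obj j) q' :=
    (hQ q).2 ⟨𝟙 Q, Category.comp_id q'⟩
  refine ⟨Q, ofIsTwoNatural _ nat, isTwoColimit_of_bijective _ fun Y => ⟨?_, ?_⟩⟩
  · intro h k hhk
    refine hq _ _ ((hζ fun j => ζ j ⋙ postcomp (F.obj j) (q' ≫ k)).unique (fun j => ?_) fun j => rfl)
    have := congrFun (congrArg WeightedCocone.app hhk) j
    exact (comp_postcomp_postcomp (ζ j) q' h).symm.trans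
      (this.trans (comp_postcomp_postcomp (ζ j) q' k))
  · intro τ
    obtain ⟨g, hg, -⟩ := hζ τ.app
    obtain ⟨k, hk⟩ := (hQ g).1 (by rw [funext hg]; exact τ.isTwoNatural)
    refine ⟨k, WeightedCocone.ext (funext fun j => ?_)⟩
    exact (comp_postcomp_postcomp (ζ j) q' k).trans
      ((congrArg (fun l : C ⟶ Y => ζ j ⋙ postcomp _ l) hk).trans (hg j))

end WeightedCocone

end

theorem mainTheorem1 (E : Type u) [Category.{v} E] [FinitaryExtensive E] [HasPullbacks E]
    [HasPullbackStableCoequalizers E]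
    (hU : (InternalCategory.forgetToGraph E).IsRightAdjoint) :
    HasFiniteTwoColimits.{wJ, vJ, uJ, vW, uW} (InternalCategory E) := by
  intro J _ _ W F _ hJ hW
  exact WeightedCocone.exists_isTwoColimit hU hJ hW
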